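/- Let $\alpha>2$, $Q_d,\rho_s,\rho_d>0$, $\lambda_s^D,\lambda_{u,s}^T\ge 0$, $0<\zeta\le 1$, $\lambda_u>0$. On a probability space let $\Phi_s^D=\{Y_j\}$ (active small cell access points in downlink), $\Phi_{u,s}^T=\{Z_l\}$ (transmitting mobile users of the small cell tier) and $\tilde\Phi_d=\{T_i\}$ (potential D2D transmitters) be homogeneous Poisson point processes (PPPs) on $\mathbb R^2$ with densities $\lambda_s^D$, $\lambda_{u,s}^T$ and $\zeta\lambda_u$. Let the fading powers $h_{ij}$ (between $T_i$ and $Y_j$), $h'_{il}$ (between $T_i$ and $Z_l$), $h''_{ik}=h''_{ki}$ (between $T_i$ and $T_k$) be i.i.d. exponential random variables with mean $1$, and let the timers $t_i$ be i.i.d. uniform on $[0,1]$; the three point processes, the fading powers and the timers are mutually independent. The CSMA retention indicator of $T_i$ is $$U_i=\prod_{j}\mathbf 1\Bigl(\tfrac{Q_dh_{ij}}{\|T_i-Y_j\|^\alpha}<\rho_s\Bigr)\prod_{l}\mathbf 1\Bigl(\tfrac{Q_dh'_{il}}{\|T_i-Z_l\|^\alpha}<\rho_s\Bigr)\prod_{k\ne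 i}\Bigl(\mathbf 1(t_i\le t_k)+\mathbf 1(t_i>t_k)\,\mathbf 1\Bigl(\tfrac{Q_dh''_{ik}}{\|T_i-T_k\|^\alpha}<\rho_d\Bigr)\Bigr).$$ Put $K_{o,s}=\dfrac{2\pi\Gamma(2/\alpha)}{\alpha(\rho_s/Q_d)^{2/\alpha}}$ and $K_{o,d}=\dfrac{2\pi\Gamma(2/\alpha)}{\alpha(\rho_d/Q_d)^{2/\alpha}}$. Then: (1) The retaining probability of a potential D2D transmitter, that is, the Palm probability $\beta=P_0[U_0=1]$, equal to $\mathbb E\,\#\{i:T_i\in B,\ U_i=1\}\,/\,\mathbb E\,\#\{i:T_i\in B\}$ for every Borel set $B$ of positive finite area, is $$\beta=e^{-(\lambda_s^D+\lambda_{u,s}^T)K_{o,s}}\;\frac{1-e^{-\zeta\lambda_uK_{o,d}}}{\zeta\lambda_uK_{o,d}}.$$ (2) The density (mean number of points per unit area) of the active D2D transmitters $\{T_i:U_i=1\}$ is $$\lambda_d=\beta\zeta\lambda_u=e^{-(\lambda_s^D+\lambda_{u,s}^T)K_{o,s}}\;\frac{1-e^{-\zeta\lambda_uK_{o,d}}}{K_{o,d}}.$$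 Moreover, under the independent-retention approximation, in which every $T_i$ is retained with probability $\beta$, independently of the other retention decisions and of $\tilde\Phi_d$, the retained transmitters form a PPP with this density $\lambda_d$. -/

import Mathlib

open MeasureTheory ProbabilityTheory

noncomputable section

/-- The Euclidean plane, with its Lebesgue measure `volume`. -/
abbrev Plane : Type := EuclideanSpace ℝ (Fin 2)

/-- A point of the plane, or no point at all (`Sum.inr ()`). -/
abbrev MaybePoint : Type := Plane ⊕ Unit

/-- The indicator of a proposition, as a real number. -/
def ind (p : Prop) : ℝ := by
  classical exact if p then 1 else 0

/-- An enumerated point process on the plane: the points are the `x` with `X n ω = Sum.inl x` for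
some `n`; indices with `X n ω = Sum.inr ()` carry no point, so that the total number of points is
random (possibly zero, finite or infinite). `count X A ω` is the number of points in `A`. -/
def count {Ω : Type*} (X : ℕ → Ω → MaybePoint) (A : Set Plane) (ω : Ω) : ℕ∞ :=
  {n : ℕ | ∃ x ∈ A, X n ω = Sum.inl x}.encard

/-- `X` is a homogeneous Poisson point process of density `lam` on the plane: the numbers of points
in sets of finite area are Poisson with mean `lam` times the area, and the numbers of points in
finitely many pairwise disjoint such sets are independent. -/
structure IsPPP {Ω : Type*} [MeasurableSpace Ω] (P : Measure Ω) (X : ℕ → Ω → MaybePoint)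
    (lam : ℝ) : Prop where
  measurable : ∀ n, Measurable (X n)
  poisson : ∀ A : Set Plane, MeasurableSet A → volume A < ⊤ → ∀ k : ℕ,
    P {ω | count X A ω = k} = poissonMeasure (lam * volume.real A).toNNReal {k}
  indep : ∀ (m : ℕ) (A : Fin m → Set Plane), (∀ i, MeasurableSet (A i)) →
    (∀ i, volume (A i) < ⊤) → (∀ i j, i ≠ j → Disjoint (A i) (A j)) →
    iIndepFun (fun i => count X (A i)) P

/-- `X` has density (mean number of points per unit area) `lam`. -/
def HasDensity {Ω : Type*} [MeasurableSpace Ω] (P : Measure Ω) (X : ℕ → Ω → MaybePoint)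
    (lam : ℝ) : Prop :=
  ∀ B : Set Plane, MeasurableSet B → volume B < ⊤ →
    ∫⁻ ω, (count X B ω : ENNReal) ∂P = ENNReal.ofReal (lam * volume.real B)

open Classical in
/-- The points of `X` whose retention indicator is equal to `1`. -/
def retained {Ω : Type*} (X : ℕ → Ω → MaybePoint) (U : ℕ → Ω → ℝ) : ℕ → Ω → MaybePoint :=
  fun i ω => if U i ω = 1 then X i ω else Sum.inr ()

/-- The Palm probability that the typical point of `X` has `U = 1`, computed with the window `B`:
the mean number of points in `B` with `U = 1` over the mean number of points in `B`. -/
def retainingProb {Ω : Type*} [MeasurableSpace Ω] (P : Measure Ω) (X : ℕ → Ω → MaybePoint)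
    (U : ℕ → Ω → ℝ) (B : Set Plane) : ENNReal :=
  (∫⁻ ω, (count (retained X U) B ω : ENNReal) ∂P) / ∫⁻ ω, (count X B ω : ENNReal) ∂P

/-- The random objects of the network: the active small cell access points `Y j` in downlink, the
transmitting mobile users `Z l` of the small cell tier, the potential D2D transmitters `T i`, the
fading powers `hY (i, j)` between `T i` and `Y j`, `hZ (i, l)` between `T i` and `Z l`, and
`hT s(i, k)` between `T i` and `T k` (reciprocal channels), and the timers `t i`. -/
structure Network (Ω : Type*) where
  Y : ℕ → Ω → MaybePoint
  Z : ℕ → Ω → MaybePoint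
  T : ℕ → Ω → MaybePoint
  hY : ℕ × ℕ → Ω → ℝ
  hZ : ℕ × ℕ → Ω → ℝ
  hT : Sym2 ℕ → Ω → ℝ
  t : ℕ → Ω → ℝ

/-- The distributional assumptions: `Y`, `Z`, `T` are Poisson point processes, the fading powers are
i.i.d. exponential of mean one, the timers are i.i.d. uniform on `[0, 1]`, and the point processes,
the fading powers and the timers are mutually independent. -/
structure Network.IsModel {Ω : Type*} [MeasurableSpace Ω] (N : Network Ω) (P : Measure Ω)
    (lamY lamZ lamT : ℝ) : Prop where
  pppY : IsPPP P N.Y lamY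
  pppZ : IsPPP P N.Z lamZ
  pppT : IsPPP P N.T lamT
  meas_hY : ∀ e, Measurable (N.hY e)
  meas_hZ : ∀ e, Measurable (N.hZ e)
  meas_hT : ∀ e, Measurable (N.hT e)
  meas_t : ∀ i, Measurable (N.t i)
  law_hY : ∀ e, HasLaw (N.hY e) (expMeasure 1) P
  law_hZ : ∀ e, HasLaw (N.hZ e) (expMeasure 1) P
  law_hT : ∀ e, HasLaw (N.hT e) (expMeasure 1) P
  law_t : ∀ i, HasLaw (N.t i) (volume.restrict (Set.Icc (0 : ℝ) 1)) P
  iid_hY : iIndepFun N.hY P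
  iid_hZ : iIndepFun N.hZ P
  iid_hT : iIndepFun N.hT P
  iid_t : iIndepFun N.t P
  indep : iIndep
    ![MeasurableSpace.comap (fun ω n => N.Y n ω) inferInstance,
      MeasurableSpace.comap (fun ω n => N.Z n ω) inferInstance,
      MeasurableSpace.comap (fun ω n => N.T n ω) inferInstance,
      MeasurableSpace.comap (fun ω e => N.hY e ω) inferInstance,
      MeasurableSpace.comap (fun ω e => N.hZ e ω) inferInstance,
      MeasurableSpace.comap (fun ω e => N.hT e ω) inferInstance,
      MeasurableSpace.comap (fun ω i => N.t i ω) inferInstance] P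

/-- The power `Q h / ‖x - y‖ ^ α` received over the link between `x` and `y` is below the threshold
`ρ` (no condition if one of the two points is absent). -/
def BelowThreshold (Q α ρ h : ℝ) (x y : MaybePoint) : Prop :=
  ∀ x' y' : Plane, x = Sum.inl x' → y = Sum.inl y' → Q * h / ‖x' - y'‖ ^ α < ρ

/-- The CSMA retention indicator of the potential D2D transmitter `T i`. -/
def Network.U {Ω : Type*} (N : Network Ω) (Q α ρs ρd : ℝ) (i : ℕ) (ω : Ω) : ℝ :=
  (∏' j : ℕ, ind (BelowThreshold Q α ρs (N.hY (i, j) ω) (N.T i ω) (N.Y j ω))) *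
  (∏' l : ℕ, ind (BelowThreshold Q α ρs (N.hZ (i, l) ω) (N.T i ω) (N.Z l ω))) *
  ∏' k : {k : ℕ // k ≠ i},
    (ind (N.t i ω ≤ N.t k ω) + ind (N.t i ω > N.t k ω) *
      ind (BelowThreshold Q α ρd (N.hT s(i, k.1) ω) (N.T i ω) (N.T k ω)))

/-- `V` is a family of i.i.d. zero-one valued retention indicators with success probability `β`,
independent of the point process `X`. -/
structure IsIndepRetention {Ω : Type*} [MeasurableSpace Ω] (P : Measure Ω)
    (X : ℕ → Ω → MaybePoint) (V : ℕ → Ω → ℝ) (β : ℝ) : Prop where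
  measurable : ∀ i, Measurable (V i)
  zero_or_one : ∀ i ω, V i ω = 0 ∨ V i ω = 1
  prob : ∀ i, P {ω | V i ω = 1} = ENNReal.ofReal β
  iid : iIndepFun V P
  indep : IndepFun (fun ω i => V i ω) (fun ω n => X n ω) P

/-- The constant `K = 2 π Γ(2/α) / (α (ρ/Q)^(2/α))`. -/
def Kconst (α ρ Q : ℝ) : ℝ :=
  2 * Real.pi * Real.Gamma (2 / α) / (α * (ρ / Q) ^ (2 / α))

/-- The closed form of the retaining probability. -/
def betaFormula (α Q ρs ρd lamY lamZ ζ lamU : ℝ) : ℝ :=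
  Real.exp (-(lamY + lamZ) * Kconst α ρs Q) *
    ((1 - Real.exp (-(ζ * lamU * Kconst α ρd Q))) / (ζ * lamU * Kconst α ρd Q))

/-- The closed form of the density of active D2D transmitters. -/
def lamDFormula (α Q ρs ρd lamY lamZ ζ lamU : ℝ) : ℝ :=
  Real.exp (-(lamY + lamZ) * Kconst α ρs Q) *
    ((1 - Real.exp (-(ζ * lamU * Kconst α ρd Q))) / Kconst α ρd Q)

end

/-! Fix a transmitter at `x` and freeze all transmitter positions. Retention is then a product of
three independent factors: one for the access points and their fadings, one for the mobile users and
theirs, one for the timers and the fadings between transmitters. A point `y` exceeds the threshold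
at `x` with probability `q = exp (-(ρ/Q) ‖x - y‖^α)`, whose integral over `y` is `Kconst` (polar
coordinates and the Gamma integral). The Laplace functional of a Poisson process
(`IsPPP.lintegral_expNeg_tsum`) turns each of the first two factors into `exp (-λ Kconst)`.

Given its own timer value `s`, the transmitter is blocked by another one with probability `s q`,
independently over the others. By the Mecke formula (`IsPPP.meckeFormula`) the other transmitters
again look Poisson from a point of the process, so the third factor becomes `exp (-ζ λ_u K s)`.
Integration over `s` in `[0, 1]` gives `(1 - exp (-a)) / a` with `a = ζ λ_u K`; this yields the
density, and division by `ζ λ_u` yields the retaining probability.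

A Poisson process is given here only through its counts. Both functionals are therefore computed for
step functions, from independent Poisson counts, and extended by increasing limits. The weights of
the Mecke formula depend on both points; they are lower semicontinuous, hence increasing limits of
functions built from finitely many open rectangles.

Independent retention is binomial thinning: conditionally on the positions the retained counts are
independent binomials, and a Poisson mixture of binomials is Poisson (`IsPPP.retained`). -/

section

open Filter Topology
open scoped ENNReal NNReal

/-! ### Exponentials on `[0, ∞]` and infinite products of probabilities. -/

/-- The function `a ↦ exp (-a)` on extended nonnegative reals. -/
noncomputable def expNeg (a : ℝ≥0∞) : ℝ≥0∞ := (EReal.exp (a : EReal))⁻¹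

/-- The function `u ↦ max (-log u) 0` on extended nonnegative reals. -/
noncomputable def negLog (u : ℝ≥0∞) : ℝ≥0∞ := (ENNReal.log u⁻¹).toENNReal

lemma expNeg_zero : expNeg 0 = 1 := by simp [expNeg]

lemma expNeg_add (a b : ℝ≥0∞) : expNeg (a + b) = expNeg a * expNeg b := by
  rw [expNeg, EReal.coe_ennreal_add, EReal.exp_add, ENNReal.mul_inv]
  · rfl
  · left; simp
  · right; simp

lemma expNeg_antitone : Antitone expNeg := fun _ _ h =>
  ENNReal.inv_le_inv.2 (EReal.exp_monotone (EReal.coe_ennreal_le_coe_ennreal_iff.2 h))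

lemma expNeg_le_one (a : ℝ≥0∞) : expNeg a ≤ 1 :=
  (expNeg_antitone (zero_le)).trans_eq expNeg_zero

lemma expNeg_ne_top (a : ℝ≥0∞) : expNeg a ≠ ⊤ := ne_top_of_le_ne_top (by simp) (expNeg_le_one a)

lemma expNeg_ne_zero {a : ℝ≥0∞} (h : a ≠ ⊤) : expNeg a ≠ 0 := by simp [expNeg, h]

lemma continuous_expNeg : Continuous expNeg :=
  continuous_inv.comp (ENNReal.continuous_exp.comp continuous_coe_ennreal_ereal)

@[fun_prop]
lemma measurable_expNeg : Measurable expNeg := continuous_expNeg.measurable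

lemma expNeg_ofReal {x : ℝ} (hx : 0 ≤ x) :
    expNeg (ENNReal.ofReal x) = ENNReal.ofReal (Real.exp (-x)) := by
  rw [expNeg, EReal.coe_ennreal_ofReal, max_eq_left hx, EReal.exp_coe, Real.exp_neg,
    ENNReal.ofReal_inv_of_pos (Real.exp_pos _)]

lemma expNeg_sum {ι : Type*} (s : Finset ι) (f : ι → ℝ≥0∞) :
    expNeg (∑ i ∈ s, f i) = ∏ i ∈ s, expNeg (f i) := by
  classical
  induction s using Finset.induction_on with
  | empty => simp [expNeg_zero]
  | insert a s ha ih => rw [Finset.sum_insert ha, Finset.prod_insert ha, expNeg_add, ih]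

lemma expNeg_negLog {u : ℝ≥0∞} (hu : u ≤ 1) : expNeg (negLog u) = u := by
  have h : (0 : EReal) ≤ ENNReal.log u⁻¹ := by
    rw [← ENNReal.log_one]
    exact ENNReal.log_monotone (ENNReal.one_le_inv.2 hu)
  rw [expNeg, negLog, EReal.coe_toENNReal h, ENNReal.exp_log, inv_inv]

lemma negLog_one : negLog 1 = 0 := by simp [negLog]

lemma negLog_antitone : Antitone negLog := fun _ _ h =>
  EReal.toENNReal_le_toENNReal (ENNReal.log_monotone (ENNReal.inv_le_inv.2 h))

@[fun_prop]
lemma measurable_negLog : Measurable negLog :=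
  measurable_ereal_toENNReal.comp (ENNReal.measurable_log.comp measurable_inv)

lemma continuous_negLog : Continuous negLog :=
  EReal.continuous_toENNReal.comp (ENNReal.continuous_log.comp continuous_inv)

/-- The infinite product of a sequence of numbers of the unit interval. -/
noncomputable def iprod (u : ℕ → ℝ≥0∞) : ℝ≥0∞ := ⨅ n, ∏ k ∈ Finset.range n, u k

lemma antitone_prod_range {u : ℕ → ℝ≥0∞} (hu : ∀ k, u k ≤ 1) :
    Antitone fun n => ∏ k ∈ Finset.range n, u k :=
  antitone_nat_of_succ_le fun n => by
    rw [Finset.prod_range_succ]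
    exact mul_le_of_le_one_right' (hu n)

/-- Exchanging products for sums makes convergence theorems for series in `[0, ∞]` available; a
vanishing factor corresponds to the weight `⊤`. -/
lemma iprod_expNeg (f : ℕ → ℝ≥0∞) : iprod (fun k => expNeg (f k)) = expNeg (∑' k, f k) := by
  have h1 := (continuous_expNeg.tendsto _).comp (ENNReal.tendsto_nat_tsum f)
  have h2 := tendsto_atTop_iInf (antitone_prod_range fun k => expNeg_le_one (f k))
  refine tendsto_nhds_unique h2 (h1.congr fun n => ?_)
  simp [expNeg_sum]

lemma iprod_eq_expNeg {u : ℕ → ℝ≥0∞} (hu : ∀ k, u k ≤ 1) :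
    iprod u = expNeg (∑' k, negLog (u k)) := by
  rw [← iprod_expNeg]
  simp_rw [expNeg_negLog (hu _)]

lemma iprod_indicator (p : ℕ → Prop) [DecidablePred p] [Decidable (∀ k, p k)] :
    iprod (fun k => if p k then 1 else 0) = if ∀ k, p k then 1 else 0 := by
  unfold iprod
  split_ifs with h
  · simp [h]
  · obtain ⟨k, hk⟩ := not_forall.1 h
    refine le_antisymm (iInf_le_of_le (k + 1) ?_) zero_le
    rw [Finset.prod_eq_zero (Finset.self_mem_range_succ k) (by simp [hk])]

lemma measurable_iprod {Ω : Type*} [MeasurableSpace Ω] {X : ℕ → Ω → ℝ≥0∞}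
    (hX : ∀ k, Measurable (X k)) : Measurable fun ω => iprod fun k => X k ω :=
  Measurable.iInf fun _ => Finset.measurable_prod _ fun k _ => hX k

/-- The mean of an infinite product of independent random variables is the product of the means. -/
lemma lintegral_iprod {Ω : Type*} [MeasurableSpace Ω] {P : Measure Ω} [IsProbabilityMeasure P]
    {X : ℕ → Ω → ℝ≥0∞} (hX : ∀ k, Measurable (X k)) (h1 : ∀ k ω, X k ω ≤ 1)
    (hi : iIndepFun X P) :
    ∫⁻ ω, iprod (fun k => X k ω) ∂P = iprod fun k => ∫⁻ ω, X k ω ∂P := by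
  unfold iprod
  rw [lintegral_iInf (fun n => Finset.measurable_prod _ fun k _ => hX k)]
  · exact iInf_congr fun n => lintegral_prod_eq_prod_lintegral_of_indepFun _ _ hi hX
  · intro _ _ h ω
    exact antitone_prod_range (fun k => h1 k ω) h
  · simp

/-! ### Generating functions of the Poisson law and counts as sums over indices. -/

lemma tsum_pow_mul_poissonMeasure (r : ℝ≥0) {w : ℝ≥0∞} (hw : w ≤ 1) :
    ∑' n : ℕ, w ^ n * poissonMeasure r {n} = expNeg (r * (1 - w)) := by
  obtain ⟨v, hv, rfl⟩ : ∃ v : ℝ, 0 ≤ v ∧ w = ENNReal.ofReal v :=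
    ⟨w.toReal, ENNReal.toReal_nonneg, (ENNReal.ofReal_toReal (ne_top_of_le_ne_top (by simp) hw)).symm⟩
  have hv1 : v ≤ 1 := by simpa using hw
  have hs : HasSum (fun n : ℕ => v ^ n * (Real.exp (-r) * r ^ n / n.factorial))
      (Real.exp (-r) * Real.exp (r * v)) := by
    have := (NormedSpace.expSeries_div_hasSum_exp (𝔸 := ℝ) (r * v)).mul_left (Real.exp (-r))
    rw [← Real.exp_eq_exp_ℝ] at this
    convert! this using 2 with n
    rw [mul_pow]; ring
  have h0 : ∀ n : ℕ, 0 ≤ v ^ n * (Real.exp (-r) * r ^ n / n.factorial) := fun n => by positivity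
  simp_rw [poissonMeasure_singleton, ← ENNReal.ofReal_pow hv, ← ENNReal.ofReal_mul (pow_nonneg hv _)]
  rw [← ENNReal.ofReal_tsum_of_nonneg h0 hs.summable, hs.tsum_eq, ← Real.exp_add,
    ← ENNReal.ofReal_one, ← ENNReal.ofReal_sub _ hv, ← ENNReal.ofReal_coe_nnreal,
    ← ENNReal.ofReal_mul (by positivity), expNeg_ofReal (mul_nonneg r.coe_nonneg (by linarith))]
  congr 2; ring

/-- The identity `(n + 1) p (n + 1) = r p n` for the Poisson weights reduces this to the generating
function. -/
lemma tsum_mul_pow_mul_poissonMeasure (r : ℝ≥0) {w : ℝ≥0∞} (hw : w ≤ 1) :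
    ∑' n : ℕ, n * w ^ n * poissonMeasure r {n} = r * w * expNeg (r * (1 - w)) := by
  rw [← tsum_pow_mul_poissonMeasure r hw, tsum_eq_zero_add' ENNReal.summable,
    ← ENNReal.tsum_mul_left]
  simp only [Nat.cast_zero, zero_mul, zero_add]
  refine tsum_congr fun n => ?_
  have : ((n + 1 : ℕ) : ℝ≥0∞) * poissonMeasure r {n + 1} = r * poissonMeasure r {n} := by
    rw [poissonMeasure_singleton, poissonMeasure_singleton, ← ENNReal.ofReal_natCast,
      ← ENNReal.ofReal_mul (by positivity), ← ENNReal.ofReal_coe_nnreal,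
      ← ENNReal.ofReal_mul (by positivity)]
    congr 1
    rw [Nat.factorial_succ]
    push_cast
    field_simp
    ring
  rw [pow_succ]
  calc _ = w ^ n * w * (((n + 1 : ℕ) : ℝ≥0∞) * poissonMeasure r {n + 1}) := by ring
    _ = _ := by rw [this]; ring

/-- Extension by zero of a function on the plane to the absent point. -/
def val (g : Plane → ℝ≥0∞) : MaybePoint → ℝ≥0∞ := Sum.elim g 0

@[simp] lemma val_inl (g : Plane → ℝ≥0∞) (x : Plane) : val g (Sum.inl x) = g x := rfl

@[simp] lemma val_inr (g : Plane → ℝ≥0∞) (u : Unit) : val g (Sum.inr u) = 0 := rfl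

lemma measurable_val {g : Plane → ℝ≥0∞} (hg : Measurable g) : Measurable (val g) :=
  Measurable.sumElim hg measurable_zero

lemma count_eq_tsum {Ω : Type*} (X : ℕ → Ω → MaybePoint) (A : Set Plane) (ω : Ω) :
    (count X A ω : ℝ≥0∞) = ∑' n, val (A.indicator 1) (X n ω) := by
  rw [count, ← ENNReal.tsum_set_one, tsum_subtype _ (fun _ => (1 : ℝ≥0∞))]
  refine tsum_congr fun n => ?_
  rcases h : X n ω with x | u
  · by_cases hx : x ∈ A <;> simp [Set.indicator, h, hx]
  · simp [Set.indicator, h]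

/-! ### Laplace transforms of the counts of a Poisson process. -/

section PPP

variable {Ω : Type*} [MeasurableSpace Ω] {P : Measure Ω} {X : ℕ → Ω → MaybePoint} {lam : ℝ}

lemma measurable_count (hX : ∀ n, Measurable (X n)) {A : Set Plane} (hA : MeasurableSet A) :
    Measurable (count X A) := by
  have h : Measurable fun ω => (count X A ω : ℝ≥0∞) := by
    simp_rw [count_eq_tsum]
    exact Measurable.tsum fun n =>
      (measurable_val (measurable_one.indicator hA)).comp (hX n)
  refine measurable_to_countable' fun k => ?_
  convert! h (measurableSet_singleton (k : ℝ≥0∞)) using 1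
  ext ω
  simp

/-- The law of the count is prescribed at finite values only. These already carry mass one, so one
inequality between two probability measures suffices and nothing is left for `⊤`. -/
lemma IsPPP.map_count [IsProbabilityMeasure P] (hX : IsPPP P X lam) {A : Set Plane}
    (hA : MeasurableSet A) (hA' : volume A < ⊤) :
    P.map (count X A) =
      (poissonMeasure (lam * volume.real A).toNNReal).map ((↑) : ℕ → ℕ∞) := by
  have hm := measurable_count hX.measurable hA
  have hc : Measurable ((↑) : ℕ → ℕ∞) := measurable_from_top
  have := Measure.isProbabilityMeasure_map (μ := P) hm.aemeasurable
  have := Measure.isProbabilityMeasure_map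
    (μ := poissonMeasure (lam * volume.real A).toNNReal) hc.aemeasurable
  refine (Measure.eq_of_le_of_isProbabilityMeasure ?_).symm
  rw [Measure.le_iff]
  intro s hs
  rw [Measure.map_apply hc hs, Measure.map_apply hm hs]
  rw [← Measure.tsum_indicator_apply_singleton _ _ (hc hs)]
  calc _ = ∑' k : ℕ, P ((count X A ⁻¹' s) ∩ {ω | count X A ω = k}) := by
        refine tsum_congr fun k => ?_
        by_cases hk : (k : ℕ∞) ∈ s
        · rw [Set.indicator_of_mem (by exact hk), ← hX.poisson A hA hA' k]
          congr 1; ext ω; simp; rintro h; rwa [h]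
        · rw [Set.indicator_of_notMem (by exact hk)]
          symm; convert measure_empty (μ := P)
          ext ω; simp; rintro h h'; rw [h'] at h; exact hk h
    _ ≤ _ := by
        rw [← measure_iUnion]
        · exact measure_mono (by simp)
        · intro i j hij
          refine Set.disjoint_left.2 fun ω h1 h2 => hij ?_
          have := h1.2.symm.trans h2.2
          exact_mod_cast this
        · intro k
          exact (hm hs).inter (hm (measurableSet_singleton (k : ℕ∞)))

lemma IsPPP.lintegral_count_comp [IsProbabilityMeasure P] (hX : IsPPP P X lam) {A : Set Plane}
    (hA : MeasurableSet A) (hA' : volume A < ⊤) (F : ℕ∞ → ℝ≥0∞) :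
    ∫⁻ ω, F (count X A ω) ∂P =
      ∑' n : ℕ, F n * poissonMeasure (lam * volume.real A).toNNReal {n} := by
  have hc : Measurable ((↑) : ℕ → ℕ∞) := measurable_from_top
  rw [← lintegral_map (f := F) measurable_from_top (measurable_count hX.measurable hA),
    hX.map_count hA hA', lintegral_map measurable_from_top hc, lintegral_countable']

lemma IsPPP.lintegral_expNeg_count [IsProbabilityMeasure P] (hX : IsPPP P X lam) (h0 : 0 ≤ lam)
    {A : Set Plane} (hA : MeasurableSet A) (hA' : volume A < ⊤) (c : ℝ≥0∞) :
    ∫⁻ ω, expNeg (c * count X A ω) ∂P =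
      expNeg (ENNReal.ofReal lam * (volume A * (1 - expNeg c))) := by
  rw [hX.lintegral_count_comp hA hA' fun n => expNeg (c * n)]
  have hp : ∀ n : ℕ, expNeg (c * n) = expNeg c ^ n := fun n => by
    simpa [mul_comm] using expNeg_sum (Finset.range n) fun _ => c
  simp only [ENat.toENNReal_coe, hp]
  rw [tsum_pow_mul_poissonMeasure _ (expNeg_le_one c), ← mul_assoc]
  congr 2
  rw [← ENNReal.ofReal, ENNReal.ofReal_mul h0, ofReal_measureReal hA'.ne]

lemma IsPPP.lintegral_count_mul_expNeg_count [IsProbabilityMeasure P] (hX : IsPPP P X lam)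
    (h0 : 0 ≤ lam) {A : Set Plane} (hA : MeasurableSet A) (hA' : volume A < ⊤) (c : ℝ≥0∞) :
    ∫⁻ ω, count X A ω * expNeg (c * count X A ω) ∂P =
      ENNReal.ofReal lam * volume A * expNeg c *
        expNeg (ENNReal.ofReal lam * (volume A * (1 - expNeg c))) := by
  rw [hX.lintegral_count_comp hA hA' fun n => n * expNeg (c * n)]
  have hp : ∀ n : ℕ, expNeg (c * n) = expNeg c ^ n := fun n => by
    simpa [mul_comm] using expNeg_sum (Finset.range n) fun _ => c
  simp only [ENat.toENNReal_coe, hp]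
  rw [tsum_mul_pow_mul_poissonMeasure _ (expNeg_le_one c), ← mul_assoc _ (volume A),
    ← ENNReal.ofReal, ENNReal.ofReal_mul h0, ofReal_measureReal hA'.ne]

lemma IsPPP.hasDensity [IsProbabilityMeasure P] (hX : IsPPP P X lam) (h0 : 0 ≤ lam) :
    HasDensity P X lam := by
  intro B hB hB'
  -- The exponent `0` removes the exponential and leaves the mean count.
  have h := hX.lintegral_count_mul_expNeg_count h0 hB hB' 0
  simp only [zero_mul, expNeg_zero, mul_one, tsub_self, mul_zero] at h
  rw [h, ENNReal.ofReal_mul h0, ofReal_measureReal hB'.ne]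

lemma IsPPP.iIndepFun_count {ι : Type*} [Fintype ι] (hX : IsPPP P X lam) {A : ι → Set Plane}
    (hA : ∀ i, MeasurableSet (A i)) (hA' : ∀ i, volume (A i) < ⊤)
    (hd : Pairwise (Function.onFun Disjoint A)) : iIndepFun (fun i => count X (A i)) P := by
  let e := Fintype.equivFin ι
  have := hX.indep _ (fun i => A (e.symm i)) (fun i => hA _) (fun i => hA' _)
    (fun i j hij => hd (by simpa using hij))
  simpa using this.precomp e.injective

lemma IsPPP.lintegral_count_mul_expNeg {ι : Type*} [Fintype ι] [IsProbabilityMeasure P]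
    (hX : IsPPP P X lam) (h0 : 0 ≤ lam) {A : ι → Set Plane}
    (hA : ∀ i, MeasurableSet (A i)) (hA' : ∀ i, volume (A i) < ⊤)
    (hd : Pairwise (Function.onFun Disjoint A)) (c : ι → ℝ≥0∞) (j : ι) :
    ∫⁻ ω, count X (A j) ω * expNeg (∑ i, c i * count X (A i) ω) ∂P =
      ENNReal.ofReal lam * volume (A j) * expNeg (c j) *
        expNeg (ENNReal.ofReal lam * ∑ i, volume (A i) * (1 - expNeg (c i))) := by
  classical
  -- The count of `A j` is inserted in the factor of index `j` only, so that the integrand is a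
  -- product of functions of independent counts.
  let F : ι → ℕ∞ → ℝ≥0∞ := fun i n => (if i = j then (n : ℝ≥0∞) else 1) * expNeg (c i * n)
  have hI := (hX.iIndepFun_count hA hA' hd).comp F fun i => measurable_from_top
  have hm : ∀ i, Measurable (F i ∘ count X (A i)) := fun i =>
    measurable_from_top.comp (measurable_count hX.measurable (hA i))
  have h := lintegral_prod_eq_prod_lintegral_of_indepFun Finset.univ _ hI hm
  simp only [F, Function.comp_apply, Finset.prod_mul_distrib, Finset.prod_ite_eq',
    Finset.mem_univ, if_true, ← expNeg_sum] at h
  rw [h, Finset.mul_sum, expNeg_sum]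
  have hi : ∀ i, ∫⁻ ω, (if i = j then (count X (A i) ω : ℝ≥0∞) else 1) *
      expNeg (c i * count X (A i) ω) ∂P =
      (if i = j then ENNReal.ofReal lam * volume (A j) * expNeg (c j) else 1) *
        expNeg (ENNReal.ofReal lam * (volume (A i) * (1 - expNeg (c i)))) := by
    intro i
    split_ifs with hij
    · subst hij
      exact hX.lintegral_count_mul_expNeg_count h0 (hA i) (hA' i) (c i)
    · simp only [one_mul]
      exact hX.lintegral_expNeg_count h0 (hA i) (hA' i) (c i)
  simp_rw [hi, Finset.prod_mul_distrib]
  simp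

lemma IsPPP.lintegral_expNeg_sum {ι : Type*} [Fintype ι] [IsProbabilityMeasure P]
    (hX : IsPPP P X lam) (h0 : 0 ≤ lam) {A : ι → Set Plane}
    (hA : ∀ i, MeasurableSet (A i)) (hA' : ∀ i, volume (A i) < ⊤)
    (hd : Pairwise (Function.onFun Disjoint A)) (c : ι → ℝ≥0∞) :
    ∫⁻ ω, expNeg (∑ i, c i * count X (A i) ω) ∂P =
        expNeg (ENNReal.ofReal lam * ∑ i, volume (A i) * (1 - expNeg (c i))) := by
  have hI := (hX.iIndepFun_count hA hA' hd).comp (fun i (n : ℕ∞) => expNeg (c i * n))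
    fun i => measurable_from_top
  have hm : ∀ i, Measurable ((fun n : ℕ∞ => expNeg (c i * n)) ∘ count X (A i)) := fun i =>
    measurable_from_top.comp (measurable_count hX.measurable (hA i))
  have h := lintegral_prod_eq_prod_lintegral_of_indepFun Finset.univ _ hI hm
  simp only [Function.comp_apply, ← expNeg_sum] at h
  rw [h, Finset.mul_sum, expNeg_sum]
  exact Finset.prod_congr rfl fun i _ => hX.lintegral_expNeg_count h0 (hA i) (hA' i) (c i)

end PPP

/-- Extension by zero of a function of two points to pairs containing an absent point. -/
def link (g : Plane → Plane → ℝ≥0∞) (x y : MaybePoint) : ℝ≥0∞ := val (fun x' => val (g x') y) x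

@[simp] lemma link_inl (g : Plane → Plane → ℝ≥0∞) (x : Plane) (y : MaybePoint) :
    link g (Sum.inl x) y = val (g x) y := rfl

lemma val_mono {g h : Plane → ℝ≥0∞} (hgh : g ≤ h) (x : MaybePoint) : val g x ≤ val h x := by
  rcases x with x | x
  · exact hgh x
  · exact le_rfl

lemma link_mono {g h : Plane → Plane → ℝ≥0∞} (hgh : g ≤ h) (x y : MaybePoint) :
    link g x y ≤ link h x y := by
  rcases x with x | x
  · exact val_mono (hgh x) y
  · exact le_rfl

/-- The point of `x`, or the origin if there is none. -/
def point : MaybePoint → Plane := Sum.elim id 0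

lemma measurable_point : Measurable point := Measurable.sumElim measurable_id measurable_zero

lemma measurable_link {g : Plane → Plane → ℝ≥0∞} (hg : Measurable (Function.uncurry g)) :
    Measurable (Function.uncurry (link g)) := by
  -- The first two factors indicate that both points are present; they cancel the arbitrary value of
  -- `point` at an absent one.
  have h : Function.uncurry (link g) = fun p => val 1 p.1 * val 1 p.2 *
      Function.uncurry g (point p.1, point p.2) := by
    ext ⟨x, y⟩
    rcases x with x | x <;> rcases y with y | y <;> simp [link, point]
  rw [h]
  have h1 := measurable_val (g := 1) measurable_one
  have h2 := measurable_point
  exact ((h1.comp measurable_fst).mul (h1.comp measurable_snd)).mul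
    (hg.comp ((h2.comp measurable_fst).prodMk (h2.comp measurable_snd)))

/-! ### The Mecke formula and the Laplace functional for step functions. -/

section Campbell

variable {Ω : Type*} [MeasurableSpace Ω] {P : Measure Ω} {X : ℕ → Ω → MaybePoint} {lam : ℝ}

/-- The mean, over the points `x` of `X` in `B`, of the product over the other points `y` of `X`
of the weights `exp (-g x y)`. -/
noncomputable def campbell (P : Measure Ω) (X : ℕ → Ω → MaybePoint) (B : Set Plane)
    (g : Plane → Plane → ℝ≥0∞) : ℝ≥0∞ :=
  ∑' i, ∫⁻ ω, val (B.indicator 1) (X i ω) *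
    expNeg (∑' k, if k = i then 0 else link g (X i ω) (X k ω)) ∂P

lemma measurable_tsum_link (hX : ∀ n, Measurable (X n)) {g : Plane → Plane → ℝ≥0∞}
    (hg : Measurable (Function.uncurry g)) (i : ℕ) :
    Measurable fun ω => ∑' k, if k = i then 0 else link g (X i ω) (X k ω) := by
  refine Measurable.tsum fun k => ?_
  split_ifs
  · exact measurable_const
  · exact (measurable_link hg).comp ((hX i).prodMk (hX k))

lemma measurable_campbell_integrand (hX : ∀ n, Measurable (X n)) {g : Plane → Plane → ℝ≥0∞}
    (hg : Measurable (Function.uncurry g)) {B : Set Plane} (hB : MeasurableSet B) (i : ℕ) :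
    Measurable fun ω => val (B.indicator 1) (X i ω) *
      expNeg (∑' k, if k = i then 0 else link g (X i ω) (X k ω)) :=
  ((measurable_val (measurable_one.indicator hB)).comp (hX i)).mul
    (measurable_expNeg.comp (measurable_tsum_link hX hg i))

lemma campbell_congr {B : Set Plane} {g g' : Plane → Plane → ℝ≥0∞} (h : ∀ x ∈ B, g x = g' x) :
    campbell P X B g = campbell P X B g' := by
  refine tsum_congr fun i => lintegral_congr fun ω => ?_
  rcases hx : X i ω with x | u
  · by_cases hxB : x ∈ B
    · simp [link, h x hxB]
    · simp [hxB]
  · simp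

lemma campbell_iUnion {ι : Type*} [Fintype ι] (hX : ∀ n, Measurable (X n))
    {g : Plane → Plane → ℝ≥0∞} (hg : Measurable (Function.uncurry g)) {B : ι → Set Plane}
    (hB : ∀ i, MeasurableSet (B i)) (hd : Pairwise (Function.onFun Disjoint B)) :
    campbell P X (⋃ i, B i) g = ∑ i, campbell P X (B i) g := by
  unfold campbell
  rw [← Summable.tsum_finsetSum fun i _ => ENNReal.summable]
  refine tsum_congr fun i => ?_
  rw [← lintegral_finsetSum _ fun j _ => measurable_campbell_integrand hX hg (hB j) i]
  refine lintegral_congr fun ω => ?_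
  rw [← Finset.sum_mul]
  congr 1
  rcases X i ω with x | u
  · simp only [val_inl]
    by_cases hx : ∃ j, x ∈ B j
    · obtain ⟨j, hj⟩ := hx
      rw [Finset.sum_eq_single j]
      · simp [hj, show ∃ i, x ∈ B i from ⟨j, hj⟩]
      · intro i _ hij
        exact Set.indicator_of_notMem (fun h => Set.disjoint_left.1 (hd hij) h hj) _
      · simp
    · have hx' := not_exists.1 hx
      simp [hx']
  · simp

/-- The Mecke formula for the weights `exp (-g x y)` and the points of `X` in `B`. -/
def MeckeFormula (P : Measure Ω) (X : ℕ → Ω → MaybePoint) (lam : ℝ) (B : Set Plane)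
    (g : Plane → Plane → ℝ≥0∞) : Prop :=
  campbell P X B g = ENNReal.ofReal lam *
    ∫⁻ x in B, expNeg (ENNReal.ofReal lam * ∫⁻ y, (1 - expNeg (g x y)))

lemma MeckeFormula.congr {B : Set Plane} (hB : MeasurableSet B) {g g' : Plane → Plane → ℝ≥0∞}
    (h : ∀ x ∈ B, g x = g' x) (hM : MeckeFormula P X lam B g) : MeckeFormula P X lam B g' := by
  unfold MeckeFormula at *
  rw [← campbell_congr h, hM]
  congr 1
  exact setLIntegral_congr_fun hB fun x hx => by simp only [h x hx]

lemma MeckeFormula.iUnion {ι : Type*} [Fintype ι] (hX : ∀ n, Measurable (X n))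
    {g : Plane → Plane → ℝ≥0∞} (hg : Measurable (Function.uncurry g)) {B : ι → Set Plane}
    (hB : ∀ i, MeasurableSet (B i)) (hd : Pairwise (Function.onFun Disjoint B))
    (hM : ∀ i, MeckeFormula P X lam (B i) g) : MeckeFormula P X lam (⋃ i, B i) g := by
  unfold MeckeFormula at *
  rw [campbell_iUnion hX hg hB hd, lintegral_iUnion hB hd, tsum_fintype, Finset.mul_sum]
  exact Finset.sum_congr rfl fun i _ => hM i

section Step

variable {ι : Type*} [Fintype ι] {A : ι → Set Plane} {c : ι → ℝ≥0∞}

/-- The function equal to `c i` on `A i`. -/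
noncomputable def stepFun (A : ι → Set Plane) (c : ι → ℝ≥0∞) (y : Plane) : ℝ≥0∞ :=
  ∑ i, (A i).indicator (fun _ => c i) y

lemma measurable_stepFun (hA : ∀ i, MeasurableSet (A i)) : Measurable (stepFun A c) :=
  Finset.measurable_sum _ fun i _ => measurable_const.indicator (hA i)

lemma stepFun_eq (hd : Pairwise (Function.onFun Disjoint A)) {j : ι} {y : Plane} (hy : y ∈ A j) :
    stepFun A c y = c j := by
  classical
  rw [stepFun, Finset.sum_eq_single j]
  · simp [hy]
  · intro i _ hij
    exact Set.indicator_of_notMem (fun h => Set.disjoint_left.1 (hd hij) h hy) _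
  · simp

lemma lintegral_one_sub_expNeg_stepFun (hA : ∀ i, MeasurableSet (A i))
    (hd : Pairwise (Function.onFun Disjoint A)) :
    ∫⁻ y, (1 - expNeg (stepFun A c y)) = ∑ i, volume (A i) * (1 - expNeg (c i)) := by
  have h : ∀ y, 1 - expNeg (stepFun A c y) =
      ∑ i, (A i).indicator (fun _ => 1 - expNeg (c i)) y := by
    intro y
    by_cases hy : ∃ j, y ∈ A j
    · obtain ⟨j, hy⟩ := hy
      rw [stepFun_eq hd hy]
      exact (stepFun_eq (c := fun i => 1 - expNeg (c i)) hd hy).symm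
    · push Not at hy
      simp [stepFun, hy, expNeg_zero]
  simp_rw [h]
  rw [lintegral_finsetSum _ fun i _ => measurable_const.indicator (hA i)]
  refine Finset.sum_congr rfl fun i _ => ?_
  rw [lintegral_indicator_const (hA i), mul_comm]

lemma tsum_val_stepFun {Ω : Type*} {X : ℕ → Ω → MaybePoint} (ω : Ω) :
    ∑' k, val (stepFun A c) (X k ω) = ∑ i, c i * count X (A i) ω := by
  simp_rw [count_eq_tsum, ← ENNReal.tsum_mul_left]
  rw [← Summable.tsum_finsetSum fun i _ => ENNReal.summable]
  refine tsum_congr fun k => ?_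
  rcases X k ω with x | u
  · refine Finset.sum_congr rfl fun i _ => ?_
    by_cases hx : x ∈ A i <;> simp [hx]
  · simp

/-- A point of `A j` has own weight `c j`. Putting it back into the sum over the other points
multiplies the Campbell mean by `expNeg (c j)` and produces an expression in the counts alone. This
factor is nonzero because `c j` is finite, and it cancels. -/
lemma IsPPP.meckeFormula_stepFun [IsProbabilityMeasure P]
    (hX : IsPPP P X lam) (h0 : 0 ≤ lam)
    (hA : ∀ i, MeasurableSet (A i)) (hA' : ∀ i, volume (A i) < ⊤)
    (hd : Pairwise (Function.onFun Disjoint A)) (hc : ∀ i, c i ≠ ⊤) (j : ι) :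
    MeckeFormula P X lam (A j) fun _ => stepFun A c := by
  have h := hX.lintegral_count_mul_expNeg h0 hA hA' hd c j
  have hm : Measurable (Function.uncurry fun _ : Plane => stepFun A c) :=
    (measurable_stepFun hA).comp measurable_snd
  have h' : ∫⁻ ω, count X (A j) ω * expNeg (∑ i, c i * count X (A i) ω) ∂P =
      expNeg (c j) * campbell P X (A j) fun _ => stepFun A c := by
    rw [campbell, ← ENNReal.tsum_mul_left]
    simp_rw [← lintegral_const_mul' _ _ (expNeg_ne_top (c j))]
    rw [← lintegral_tsum fun i =>
      ((measurable_campbell_integrand hX.measurable hm (hA j) i).const_mul _).aemeasurable]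
    refine lintegral_congr fun ω => ?_
    rw [count_eq_tsum, ← ENNReal.tsum_mul_right]
    refine tsum_congr fun i => ?_
    rw [← tsum_val_stepFun, ENNReal.tsum_eq_add_tsum_ite i, expNeg_add]
    rcases hx : X i ω with x | u
    · by_cases hxA : x ∈ A j
      · simp [hxA, stepFun_eq hd hxA]
        congr!
      · simp [hxA]
    · simp
  rw [h', mul_comm _ (expNeg (c j)), mul_assoc] at h
  have := (ENNReal.mul_right_inj (expNeg_ne_zero (hc j)) (expNeg_ne_top _)).1 h
  rw [MeckeFormula, this, setLIntegral_const, lintegral_one_sub_expNeg_stepFun hA hd]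
  ring

lemma IsPPP.lintegral_expNeg_stepFun [IsProbabilityMeasure P]
    (hX : IsPPP P X lam) (h0 : 0 ≤ lam)
    (hA : ∀ i, MeasurableSet (A i)) (hA' : ∀ i, volume (A i) < ⊤)
    (hd : Pairwise (Function.onFun Disjoint A)) :
    ∫⁻ ω, expNeg (∑' k, val (stepFun A c) (X k ω)) ∂P =
      expNeg (ENNReal.ofReal lam * ∫⁻ y, (1 - expNeg (stepFun A c y))) := by
  simp_rw [tsum_val_stepFun, hX.lintegral_expNeg_sum h0 hA hA' hd,
    lintegral_one_sub_expNeg_stepFun hA hd]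

end Step

end Campbell

/-! ### Increasing limits in the Mecke formula and in the Laplace functional. -/

lemma ENNReal.tendsto_tsum_of_monotone {a : ℕ → ℕ → ℝ≥0∞} {b : ℕ → ℝ≥0∞}
    (hm : ∀ k, Monotone fun n => a n k) (ht : ∀ k, Tendsto (fun n => a n k) atTop (𝓝 (b k))) :
    Tendsto (fun n => ∑' k, a n k) atTop (𝓝 (∑' k, b k)) := by
  simp_rw [← lintegral_count]
  exact lintegral_tendsto_of_tendsto_of_monotone (fun n => measurable_from_top.aemeasurable)
    (ae_of_all _ hm) (ae_of_all _ ht)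

lemma ENNReal.tendsto_tsum_of_dominated {a : ℕ → ℕ → ℝ≥0∞} {b : ℕ → ℝ≥0∞} (d : ℕ → ℝ≥0∞)
    (hd : ∑' k, d k ≠ ⊤) (ha : ∀ n k, a n k ≤ d k)
    (ht : ∀ k, Tendsto (fun n => a n k) atTop (𝓝 (b k))) :
    Tendsto (fun n => ∑' k, a n k) atTop (𝓝 (∑' k, b k)) := by
  simp_rw [← lintegral_count] at hd ⊢
  exact tendsto_lintegral_of_dominated_convergence d (fun n => measurable_from_top)
    (fun n => ae_of_all _ (ha n)) hd (ae_of_all _ ht)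

lemma val_indicator_one_le (B : Set Plane) (x : MaybePoint) : val (B.indicator 1) x ≤ 1 := by
  rcases x with x | u
  · by_cases hx : x ∈ B <;> simp [hx]
  · simp

lemma tendsto_val {G : ℕ → Plane → ℝ≥0∞} {g : Plane → ℝ≥0∞}
    (h : ∀ y, Tendsto (fun n => G n y) atTop (𝓝 (g y))) (y : MaybePoint) :
    Tendsto (fun n => val (G n) y) atTop (𝓝 (val g y)) := by
  rcases y with y | u
  · exact h y
  · exact tendsto_const_nhds

lemma tendsto_link {G : ℕ → Plane → Plane → ℝ≥0∞} {g : Plane → Plane → ℝ≥0∞}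
    (h : ∀ x y, Tendsto (fun n => G n x y) atTop (𝓝 (g x y))) (x y : MaybePoint) :
    Tendsto (fun n => link (G n) x y) atTop (𝓝 (link g x y)) := by
  rcases x with x | u
  · exact tendsto_val (h x) y
  · exact tendsto_const_nhds

lemma tendsto_expNeg_const_mul {Λ : ℝ≥0∞} (hΛ : Λ ≠ ⊤) {a : ℕ → ℝ≥0∞} {b : ℝ≥0∞}
    (h : Tendsto a atTop (𝓝 b)) :
    Tendsto (fun n => expNeg (Λ * a n)) atTop (𝓝 (expNeg (Λ * b))) :=
  (continuous_expNeg.tendsto _).comp (ENNReal.Tendsto.const_mul h (Or.inr hΛ))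

lemma tendsto_lintegral_one_sub_expNeg {G : ℕ → Plane → ℝ≥0∞} {g : Plane → ℝ≥0∞}
    (hG : ∀ n, Measurable (G n)) (hm : Monotone G)
    (h : ∀ y, Tendsto (fun n => G n y) atTop (𝓝 (g y))) :
    Tendsto (fun n => ∫⁻ y, (1 - expNeg (G n y))) atTop (𝓝 (∫⁻ y, (1 - expNeg (g y)))) := by
  refine lintegral_tendsto_of_tendsto_of_monotone
    (fun n => (measurable_const.sub (measurable_expNeg.comp (hG n))).aemeasurable)
    (ae_of_all _ fun y m n hmn => tsub_le_tsub_left (expNeg_antitone (hm hmn y)) 1)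
    (ae_of_all _ fun y => ?_)
  exact ENNReal.Tendsto.sub tendsto_const_nhds ((continuous_expNeg.tendsto _).comp (h y))
    (Or.inl (by simp))

section Limits

variable {Ω : Type*} [MeasurableSpace Ω] {P : Measure Ω} {X : ℕ → Ω → MaybePoint} {lam : ℝ}

lemma measurable_tsum_val (hX : ∀ n, Measurable (X n)) {g : Plane → ℝ≥0∞} (hg : Measurable g) :
    Measurable fun ω => ∑' k, val g (X k ω) :=
  Measurable.tsum fun k => (measurable_val hg).comp (hX k)

lemma lintegral_count_eq_tsum (hX : ∀ n, Measurable (X n)) {B : Set Plane}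
    (hB : MeasurableSet B) :
    ∫⁻ ω, count X B ω ∂P = ∑' i, ∫⁻ ω, val (B.indicator 1) (X i ω) ∂P := by
  simp_rw [count_eq_tsum]
  exact lintegral_tsum fun i =>
    ((measurable_val (measurable_one.indicator hB)).comp (hX i)).aemeasurable

/-- The Campbell means converge by domination by the mean number of points in `B`, finite since `B`
has finite area. Inside the exponentials convergence is monotone, so the limit weights may be
infinite or have infinite sums. -/
lemma MeckeFormula.of_tendsto [IsProbabilityMeasure P] (hX : IsPPP P X lam) (h0 : 0 ≤ lam)
    {B : Set Plane} (hB : MeasurableSet B) (hB' : volume B < ⊤)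
    {G : ℕ → Plane → Plane → ℝ≥0∞} {g : Plane → Plane → ℝ≥0∞}
    (hG : ∀ n, Measurable (Function.uncurry (G n))) (hm : Monotone G)
    (h : ∀ x y, Tendsto (fun n => G n x y) atTop (𝓝 (g x y)))
    (hM : ∀ n, MeckeFormula P X lam B (G n)) : MeckeFormula P X lam B g := by
  have hl : Tendsto (fun n => campbell P X B (G n)) atTop (𝓝 (campbell P X B g)) := by
    refine ENNReal.tendsto_tsum_of_dominated (fun i => ∫⁻ ω, val (B.indicator 1) (X i ω) ∂P) ?_
      (fun n i => lintegral_mono fun ω => mul_le_of_le_one_right' (expNeg_le_one _))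
      fun i => ?_
    · rw [← lintegral_count_eq_tsum hX.measurable hB, hX.hasDensity h0 B hB hB']
      exact ENNReal.ofReal_ne_top
    · refine tendsto_lintegral_of_dominated_convergence 1
        (fun n => measurable_campbell_integrand hX.measurable (hG n) hB i)
        (fun n => ae_of_all _ fun ω =>
          mul_le_one' (val_indicator_one_le B _) (expNeg_le_one _)) (by simp)
        (ae_of_all _ fun ω => ENNReal.Tendsto.const_mul
          ((continuous_expNeg.tendsto _).comp (ENNReal.tendsto_tsum_of_monotone (fun k => ?_)
            fun k => ?_))
          (Or.inr (ne_top_of_le_ne_top (by simp) (val_indicator_one_le B _))))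
      · intro m n hmn
        dsimp only
        split_ifs
        · exact le_rfl
        · exact link_mono (hm hmn) _ _
      · split_ifs
        · exact tendsto_const_nhds
        · exact tendsto_link h _ _
  have hr : Tendsto (fun n => ENNReal.ofReal lam *
      ∫⁻ x in B, expNeg (ENNReal.ofReal lam * ∫⁻ y, (1 - expNeg (G n x y)))) atTop
      (𝓝 (ENNReal.ofReal lam *
        ∫⁻ x in B, expNeg (ENNReal.ofReal lam * ∫⁻ y, (1 - expNeg (g x y))))) := by
    refine ENNReal.Tendsto.const_mul ?_ (Or.inr ENNReal.ofReal_ne_top)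
    refine tendsto_lintegral_of_dominated_convergence 1 (fun n => ?_)
      (fun n => ae_of_all _ fun x => expNeg_le_one _) (by simpa using hB'.ne)
      (ae_of_all _ fun x => tendsto_expNeg_const_mul ENNReal.ofReal_ne_top
        (tendsto_lintegral_one_sub_expNeg (fun n => (hG n).of_uncurry_left)
          (fun m n hmn => hm hmn x) (h x)))
    have : Measurable fun x => ∫⁻ y, (1 - expNeg (G n x y)) :=
      Measurable.lintegral_prod_right'
        (f := fun p : Plane × Plane => 1 - expNeg (Function.uncurry (G n) p))
        (measurable_const.sub (measurable_expNeg.comp (hG n)))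
    exact measurable_expNeg.comp (this.const_mul _)
  exact tendsto_nhds_unique hl (hr.congr fun n => (hM n).symm)

/-- Increasing approximation of `g` by simple functions that vanish outside of bounded sets. -/
noncomputable def truncApprox (B : Set Plane) (g : Plane → ℝ≥0∞) (n : ℕ) (y : Plane) : ℝ≥0∞ :=
  (B ∪ Metric.closedBall 0 n).indicator (SimpleFunc.eapprox g n) y

lemma monotone_truncApprox (B : Set Plane) (g : Plane → ℝ≥0∞) : Monotone (truncApprox B g) := by
  intro m n hmn y
  have hmn' : (m : ℝ) ≤ n := by exact_mod_cast hmn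
  refine (Set.indicator_le_indicator_of_subset (Set.union_subset_union_right _
    (Metric.closedBall_subset_closedBall hmn')) (fun _ => zero_le) y).trans ?_
  exact Set.indicator_le_indicator (SimpleFunc.monotone_eapprox g hmn y)

lemma tendsto_truncApprox (B : Set Plane) {g : Plane → ℝ≥0∞} (hg : Measurable g) (y : Plane) :
    Tendsto (fun n => truncApprox B g n y) atTop (𝓝 (g y)) := by
  refine (SimpleFunc.tendsto_eapprox hg y).congr' ?_
  filter_upwards [eventually_ge_atTop ⌈‖y‖⌉₊] with n hn
  rw [truncApprox, Set.indicator_of_mem]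
  right
  simpa using (Nat.le_ceil _).trans (by exact_mod_cast hn : ((⌈‖y‖⌉₊ : ℕ) : ℝ) ≤ n)

/-- The cells of the partition of `B ∪ closedBall 0 n` by `B` and by the values of the
approximation. -/
def cell (B : Set Plane) (g : Plane → ℝ≥0∞) (n : ℕ)
    (e : (SimpleFunc.eapprox g n).range × Bool) : Set Plane :=
  SimpleFunc.eapprox g n ⁻¹' {e.1.1} ∩ bif e.2 then B else Metric.closedBall 0 n \ B

lemma measurableSet_cell {B : Set Plane} (hB : MeasurableSet B) (g : Plane → ℝ≥0∞) (n : ℕ)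
    (e : (SimpleFunc.eapprox g n).range × Bool) : MeasurableSet (cell B g n e) := by
  refine (SimpleFunc.measurableSet_fiber _ _).inter ?_
  cases e.2
  · exact Metric.isClosed_closedBall.measurableSet.diff hB
  · exact hB

lemma volume_cell_lt_top {B : Set Plane} (hB : volume B < ⊤) (g : Plane → ℝ≥0∞) (n : ℕ)
    (e : (SimpleFunc.eapprox g n).range × Bool) : volume (cell B g n e) < ⊤ := by
  refine (measure_mono Set.inter_subset_right).trans_lt ?_
  cases e.2
  · exact (measure_mono Set.sdiff_subset).trans_lt measure_closedBall_lt_top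
  · exact hB

lemma disjoint_cell (B : Set Plane) (g : Plane → ℝ≥0∞) (n : ℕ) :
    Pairwise (Function.onFun Disjoint (cell B g n)) := by
  rintro ⟨⟨a, ha⟩, b⟩ ⟨⟨a', ha'⟩, b'⟩ hne
  refine Set.disjoint_left.2 fun y h h' => hne ?_
  have h1 : a = a' := h.1.symm.trans h'.1
  subst h1
  have h2 := h.2
  have h3 := h'.2
  cases b <;> cases b' <;> simp_all

lemma stepFun_cell (B : Set Plane) (g : Plane → ℝ≥0∞) (n : ℕ) :
    stepFun (cell B g n) (fun e => e.1.1) = truncApprox B g n := by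
  ext y
  by_cases hy : ∃ e, y ∈ cell B g n e
  · obtain ⟨e, he⟩ := hy
    rw [stepFun_eq (disjoint_cell B g n) he, truncApprox, Set.indicator_of_mem]
    · exact he.1.symm
    · have := he.2
      cases h : e.2 <;> simp_all
  · have hy' : y ∉ B ∪ Metric.closedBall 0 n := by
      intro h
      have hr := SimpleFunc.mem_range_self (SimpleFunc.eapprox g n) y
      by_cases hB : y ∈ B
      · exact hy ⟨(⟨_, hr⟩, true), rfl, hB⟩
      · exact hy ⟨(⟨_, hr⟩, false), rfl, h.resolve_left hB, hB⟩
    rw [truncApprox, Set.indicator_of_notMem hy', stepFun]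
    exact Finset.sum_eq_zero fun e _ => Set.indicator_of_notMem (fun h => hy ⟨e, h⟩) _

/-- The Laplace functional of a Poisson point process. -/
theorem IsPPP.lintegral_expNeg_tsum [IsProbabilityMeasure P] (hX : IsPPP P X lam) (h0 : 0 ≤ lam)
    {g : Plane → ℝ≥0∞} (hg : Measurable g) :
    ∫⁻ ω, expNeg (∑' k, val g (X k ω)) ∂P =
      expNeg (ENNReal.ofReal lam * ∫⁻ y, (1 - expNeg (g y))) := by
  have hG : ∀ n, Measurable (truncApprox ∅ g n) := fun n => by
    rw [← stepFun_cell]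
    exact measurable_stepFun (measurableSet_cell MeasurableSet.empty g n)
  have hl : Tendsto (fun n => ∫⁻ ω, expNeg (∑' k, val (truncApprox ∅ g n) (X k ω)) ∂P) atTop
      (𝓝 (∫⁻ ω, expNeg (∑' k, val g (X k ω)) ∂P)) := by
    refine tendsto_lintegral_of_dominated_convergence 1
      (fun n => measurable_expNeg.comp (measurable_tsum_val hX.measurable (hG n)))
      (fun n => ae_of_all _ fun ω => expNeg_le_one _) (by simp)
      (ae_of_all _ fun ω => (continuous_expNeg.tendsto _).comp
        (ENNReal.tendsto_tsum_of_monotone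
          (fun k m n hmn => val_mono (monotone_truncApprox ∅ g hmn) _)
          fun k => tendsto_val (tendsto_truncApprox ∅ hg) _))
  refine tendsto_nhds_unique hl ((tendsto_expNeg_const_mul ENNReal.ofReal_ne_top
    (tendsto_lintegral_one_sub_expNeg hG (monotone_truncApprox ∅ g)
      (tendsto_truncApprox ∅ hg))).congr fun n => ?_)
  rw [← stepFun_cell]
  exact (hX.lintegral_expNeg_stepFun h0 (measurableSet_cell MeasurableSet.empty g n)
    (volume_cell_lt_top (by simp) g n) (disjoint_cell ∅ g n)).symm

lemma IsPPP.meckeFormula_const [IsProbabilityMeasure P] (hX : IsPPP P X lam) (h0 : 0 ≤ lam)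
    {B : Set Plane} (hB : MeasurableSet B) (hB' : volume B < ⊤)
    {g : Plane → ℝ≥0∞} (hg : Measurable g) : MeckeFormula P X lam B fun _ => g := by
  have hG : ∀ n, Measurable (truncApprox B g n) := fun n => by
    rw [← stepFun_cell]
    exact measurable_stepFun (measurableSet_cell hB g n)
  refine MeckeFormula.of_tendsto hX h0 hB hB' (G := fun n _ => truncApprox B g n)
    (fun n => (hG n).comp measurable_snd) (fun m n hmn _ => monotone_truncApprox B g hmn)
    (fun _ => tendsto_truncApprox B hg) fun n => ?_
  -- The cells marked `true` partition `B` into sets on which the step function is constant, where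
  -- the step function case applies; the cells marked `false` only carry other points.
  have hBu : B = ⋃ a : (SimpleFunc.eapprox g n).range, cell B g n (a, true) := by
    ext y
    simp [cell]
  have := MeckeFormula.iUnion (P := P) (lam := lam) hX.measurable
    (g := fun _ => truncApprox B g n) ((hG n).comp measurable_snd)
    (B := fun a => cell B g n (a, true)) (fun a => measurableSet_cell hB g n _)
    (fun a a' h => disjoint_cell B g n (by simpa using h)) fun a => by
      rw [← stepFun_cell]
      refine hX.meckeFormula_stepFun h0 (measurableSet_cell hB g n)
        (volume_cell_lt_top hB' g n) (disjoint_cell B g n) (fun e => ?_) (a, true)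
      obtain ⟨y, hy⟩ := SimpleFunc.mem_range.1 e.1.2
      rw [← hy]
      exact (SimpleFunc.eapprox_lt_top g n y).ne
  rwa [← hBu] at this

end Limits

/-! ### Approximation of two-point weights by finitely many open rectangles. -/

section RectApprox

lemma exists_countableBasis_eq_range :
    ∃ f : ℕ → Set Plane, TopologicalSpace.countableBasis Plane = Set.range f := by
  refine (TopologicalSpace.countable_countableBasis Plane).exists_eq_range ?_
  obtain ⟨v, hv, -⟩ := (TopologicalSpace.isBasis_countableBasis Plane).exists_subset_of_mem_open
    (Set.mem_univ (0 : Plane)) isOpen_univ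
  exact ⟨v, hv⟩

/-- An enumeration of a countable basis of the topology of the plane. -/
noncomputable def planeBasis : ℕ → Set Plane :=
  exists_countableBasis_eq_range.choose

lemma range_planeBasis : Set.range planeBasis = TopologicalSpace.countableBasis Plane :=
  exists_countableBasis_eq_range.choose_spec.symm

lemma isTopologicalBasis_planeBasis : TopologicalSpace.IsTopologicalBasis (Set.range planeBasis) :=
  range_planeBasis ▸ TopologicalSpace.isBasis_countableBasis Plane

lemma measurableSet_planeBasis (m : ℕ) : MeasurableSet (planeBasis m) :=
  (isTopologicalBasis_planeBasis.isOpen (Set.mem_range_self m)).measurableSet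

/-- The data of an open rectangle and of a constant. -/
noncomputable def rectIndex : ℕ ≃ ℕ × ℕ × ℕ := (Denumerable.eqv (ℕ × ℕ × ℕ)).symm

/-- The first side of the rectangle of index `m`. -/
noncomputable def rectFst (m : ℕ) : Set Plane := planeBasis (rectIndex m).1

/-- The second side of the rectangle of index `m`. -/
noncomputable def rectSnd (m : ℕ) : Set Plane := planeBasis (rectIndex m).2.1

/-- The constant of index `m`. -/
noncomputable def rectConst (m : ℕ) : ℝ≥0∞ := TopologicalSpace.denseSeq ℝ≥0∞ (rectIndex m).2.2

open Classical in
/-- The supremum of the constants that minorize `g` on the rectangle of the same index, over the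
indices `m < n` such that the rectangle contains the point (the first coordinate of the point
being given by the sets `rectFst m` containing it). -/
noncomputable def rectSup (g : Plane → Plane → ℝ≥0∞) (n : ℕ) (a : Fin n → Prop) (y : Plane) :
    ℝ≥0∞ :=
  ⨆ m : Fin n, if (∀ x ∈ rectFst m, ∀ y ∈ rectSnd m, rectConst m ≤ g x y) ∧ a m ∧ y ∈ rectSnd m
    then rectConst m else 0

/-- The sets `rectFst m`, `m < n`, containing `x`. -/
def rectCode (n : ℕ) (x : Plane) : Fin n → Prop := fun m => x ∈ rectFst m

/-- An increasing approximation of a lower semicontinuous function. -/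
noncomputable def rectApprox (g : Plane → Plane → ℝ≥0∞) (n : ℕ) (x y : Plane) : ℝ≥0∞ :=
  rectSup g n (rectCode n x) y

lemma measurable_rectCode (n : ℕ) : Measurable (rectCode n) :=
  measurable_pi_lambda _ fun _ => measurable_mem.2 (measurableSet_planeBasis _)

lemma measurable_rectSup (g : Plane → Plane → ℝ≥0∞) (n : ℕ) (a : Fin n → Prop) :
    Measurable (rectSup g n a) := by
  classical
  refine Measurable.iSup fun m => Measurable.ite ?_ measurable_const measurable_const
  exact (MeasurableSet.const _).inter ((MeasurableSet.const _).inter (measurableSet_planeBasis _))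

lemma measurable_rectApprox (g : Plane → Plane → ℝ≥0∞) (n : ℕ) :
    Measurable (Function.uncurry (rectApprox g n)) := by
  classical
  refine Measurable.iSup fun m => Measurable.ite ?_ measurable_const measurable_const
  exact (MeasurableSet.const _).inter
    (((measurableSet_planeBasis _).preimage measurable_fst).inter
      ((measurableSet_planeBasis _).preimage measurable_snd))

lemma monotone_rectApprox (g : Plane → Plane → ℝ≥0∞) : Monotone (rectApprox g) := by
  intro m n hmn x y
  refine iSup_le fun k => ?_
  exact le_iSup_of_le (Fin.castLE hmn k) le_rfl

lemma rectApprox_le (g : Plane → Plane → ℝ≥0∞) (n : ℕ) : rectApprox g n ≤ g := by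
  intro x y
  refine iSup_le fun k => ?_
  split_ifs with h
  · exact h.1 x h.2.1 y h.2.2
  · exact zero_le

/-- For `b < g x y`, a constant of the dense sequence lies strictly between, and by lower
semicontinuity it stays below `g` on a basic rectangle around `(x, y)`. That rectangle enters the
supremum once `n` exceeds its index. -/
lemma tendsto_rectApprox {g : Plane → Plane → ℝ≥0∞}
    (hg : LowerSemicontinuous (Function.uncurry g)) (x y : Plane) :
    Tendsto (fun n => rectApprox g n x y) atTop (𝓝 (g x y)) := by
  have h := tendsto_atTop_iSup fun m n hmn => monotone_rectApprox g hmn x y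
  convert h
  refine le_antisymm (le_of_forall_lt fun b hb => ?_) (iSup_le fun n => rectApprox_le g n x y)
  obtain ⟨k, hq⟩ := (TopologicalSpace.denseRange_denseSeq ℝ≥0∞).exists_mem_open isOpen_Ioo
    (Set.nonempty_Ioo.2 hb)
  have hev := hg (x, y) _ hq.2
  rw [nhds_prod_eq] at hev
  obtain ⟨⟨_, _⟩, ⟨⟨⟨i, rfl⟩, hxi⟩, ⟨⟨j, rfl⟩, hyj⟩⟩, hUV⟩ :=
    ((isTopologicalBasis_planeBasis.nhds_hasBasis (a := x)).prod
      (isTopologicalBasis_planeBasis.nhds_hasBasis (a := y))).eventually_iff.1 hev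
  obtain ⟨m, hm⟩ := rectIndex.surjective (i, j, k)
  refine hq.1.trans_le (le_iSup_of_le (m + 1) (le_iSup_of_le (Fin.last m) ?_))
  have h1 : rectFst m = planeBasis i := by rw [rectFst, hm]
  have h2 : rectSnd m = planeBasis j := by rw [rectSnd, hm]
  have h3 : rectConst m = TopologicalSpace.denseSeq ℝ≥0∞ k := by rw [rectConst, hm]
  refine le_of_le_of_eq h3.ge (if_pos ⟨fun x' hx' y' hy' => ?_, ?_, ?_⟩).symm
  · exact h3.trans_le (hUV (x := (x', y')) ⟨h1 ▸ hx', h2 ▸ hy'⟩).le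
  · change x ∈ rectFst m
    rwa [h1]
  · change y ∈ rectSnd m
    rwa [h2]

end RectApprox

/-- The Mecke formula of a Poisson point process, for lower semicontinuous weights. -/
theorem IsPPP.meckeFormula {Ω : Type*} [MeasurableSpace Ω] {P : Measure Ω}
    {X : ℕ → Ω → MaybePoint} {lam : ℝ} [IsProbabilityMeasure P] (hX : IsPPP P X lam)
    (h0 : 0 ≤ lam) {B : Set Plane} (hB : MeasurableSet B) (hB' : volume B < ⊤)
    {g : Plane → Plane → ℝ≥0∞} (hg : LowerSemicontinuous (Function.uncurry g)) :
    MeckeFormula P X lam B g := by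
  refine MeckeFormula.of_tendsto hX h0 hB hB' (measurable_rectApprox g) (monotone_rectApprox g)
    (tendsto_rectApprox hg) fun n => ?_
  -- The approximation depends on `x` only through its code, which takes finitely many values. On
  -- each piece of `B` with constant code the weight is a function of `y` alone, and
  -- `IsPPP.meckeFormula_const` applies.
  have hBu : B = ⋃ a : Fin n → Prop, B ∩ rectCode n ⁻¹' {a} := by
    ext y
    simp
  have hm : ∀ a : Fin n → Prop, MeasurableSet (B ∩ rectCode n ⁻¹' {a}) := fun a =>
    hB.inter (measurable_rectCode n (measurableSet_singleton a))
  have := MeckeFormula.iUnion (P := P) (lam := lam) hX.measurable (measurable_rectApprox g n) hm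
    (fun a a' h => Set.disjoint_left.2 fun y hy hy' => h (hy.2.symm.trans hy'.2)) fun a =>
      (hX.meckeFormula_const h0 (hm a) ((measure_mono Set.inter_subset_left).trans_lt hB')
        (measurable_rectSup g n a)).congr (hm a) fun x hx => by
          ext y
          rw [rectApprox, show rectCode n x = a from hx.2]
  rwa [← hBu] at this

/-! ### Probability of exceeding the threshold and its integral over the plane. -/

/-- The probability that the power received over the link between `x` and `y` reaches the
threshold, where `c` is the ratio of the threshold to the transmitted power. -/
noncomputable def exceedProb (c α : ℝ) (x y : Plane) : ℝ≥0∞ :=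
  {p : Plane × Plane | p.1 ≠ p.2}.indicator
    (fun p => ENNReal.ofReal (Real.exp (-(c * ‖p.1 - p.2‖ ^ α)))) (x, y)

lemma exceedProb_self (c α : ℝ) (x : Plane) : exceedProb c α x x = 0 := by simp [exceedProb]

lemma exceedProb_of_ne (c α : ℝ) {x y : Plane} (h : x ≠ y) :
    exceedProb c α x y = ENNReal.ofReal (Real.exp (-(c * ‖x - y‖ ^ α))) := by
  simp [exceedProb, h]

lemma exceedProb_le_one {c : ℝ} (hc : 0 < c) (α : ℝ) (x y : Plane) : exceedProb c α x y ≤ 1 := by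
  by_cases h : x = y
  · simp [h, exceedProb_self]
  · rw [exceedProb_of_ne c α h, ENNReal.ofReal_le_one]
    exact Real.exp_le_one_iff.2 (by have := Real.rpow_nonneg (norm_nonneg (x - y)) α; nlinarith)

/-- The function is continuous on the open complement of the diagonal, and on the diagonal it takes
the least possible value `0`. -/
lemma lowerSemicontinuous_exceedProb (c : ℝ) {α : ℝ} (hα : 0 < α) :
    LowerSemicontinuous (Function.uncurry (exceedProb c α)) := by
  have hc : Continuous fun p : Plane × Plane =>
      ENNReal.ofReal (Real.exp (-(c * ‖p.1 - p.2‖ ^ α))) := by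
    refine ENNReal.continuous_ofReal.comp (Real.continuous_exp.comp (Continuous.neg
      (continuous_const.mul (Continuous.rpow_const ?_ fun _ => Or.inr hα.le))))
    fun_prop
  have hop : IsOpen {p : Plane × Plane | p.1 ≠ p.2} := isOpen_ne_fun continuous_fst continuous_snd
  intro p b hb
  by_cases hp : p.1 ≠ p.2
  · have h1 : b < ENNReal.ofReal (Real.exp (-(c * ‖p.1 - p.2‖ ^ α))) := by
      rwa [← exceedProb_of_ne c α hp]
    filter_upwards [hop.mem_nhds hp, hc.continuousAt.eventually_const_lt h1] with q hq hq'
    rwa [← exceedProb_of_ne c α hq] at hq'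
  · push Not at hp
    obtain ⟨x, y⟩ := p
    simp only at hp
    subst hp
    simp [exceedProb_self] at hb

lemma measurable_exceedProb (c : ℝ) {α : ℝ} (hα : 0 < α) :
    Measurable (Function.uncurry (exceedProb c α)) :=
  (lowerSemicontinuous_exceedProb c hα).measurable

lemma integral_exp_neg_mul_norm_rpow {c α : ℝ} (hc : 0 < c) (hα : 0 < α) :
    ∫ y : Plane, Real.exp (-(c * ‖y‖ ^ α)) =
      2 * Real.pi * Real.Gamma (2 / α) / (α * c ^ (2 / α)) := by
  -- Polar coordinates reduce the integral to a radial one with density `r`, which is a Gamma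
  -- integral.
  have h := integral_fun_norm_addHaar (E := Plane) (F := ℝ) volume
    fun r => Real.exp (-(c * r ^ α))
  have h2 := integral_rpow_mul_exp_neg_mul_rpow (q := 1) (b := c) hα (by norm_num) hc
  have hb : volume.real (Metric.ball (0 : Plane) 1) = Real.pi := by
    simp [Measure.real, EuclideanSpace.volume_ball_fin_two, Real.pi_nonneg]
  rw [h, hb]
  have h3 : ∫ r in Set.Ioi (0 : ℝ), r ^ (Module.finrank ℝ Plane - 1) • Real.exp (-(c * r ^ α)) =
      ∫ r in Set.Ioi (0 : ℝ), r ^ (1 : ℝ) * Real.exp (-c * r ^ α) := by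
    simp
  rw [h3, h2, show (1 : ℝ) + 1 = 2 by norm_num, neg_div, Real.rpow_neg hc.le]
  simp
  field_simp

/-- The value of the integral is known without integrability and is positive, whereas the integral
of a non-integrable function is `0`. -/
lemma integrable_exp_neg_mul_norm_rpow {c α : ℝ} (hc : 0 < c) (hα : 0 < α) :
    Integrable fun y : Plane => Real.exp (-(c * ‖y‖ ^ α)) := by
  by_contra h
  have h1 := integral_exp_neg_mul_norm_rpow hc hα
  rw [integral_undef h] at h1
  have := Real.Gamma_pos_of_pos (show 0 < 2 / α by positivity)
  have : 0 < 2 * Real.pi * Real.Gamma (2 / α) / (α * c ^ (2 / α)) := by positivity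
  linarith

lemma Kconst_pos {α ρ Q : ℝ} (hα : 0 < α) (hρ : 0 < ρ) (hQ : 0 < Q) : 0 < Kconst α ρ Q := by
  have := Real.Gamma_pos_of_pos (show 0 < 2 / α by positivity)
  unfold Kconst
  positivity

lemma lintegral_exceedProb {α ρ Q : ℝ} (hα : 0 < α) (hρ : 0 < ρ) (hQ : 0 < Q) (x : Plane) :
    ∫⁻ y, exceedProb (ρ / Q) α x y = ENNReal.ofReal (Kconst α ρ Q) := by
  have hc : 0 < ρ / Q := div_pos hρ hQ
  have h1 : ∫⁻ y, exceedProb (ρ / Q) α x y =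
      ∫⁻ y, ENNReal.ofReal (Real.exp (-(ρ / Q * ‖x - y‖ ^ α))) := by
    refine lintegral_congr_ae ?_
    have : ∀ᵐ y : Plane, y ≠ x := by simp [ae_iff]
    filter_upwards [this] with y hy
    exact exceedProb_of_ne _ _ hy.symm
  rw [h1, lintegral_sub_left_eq_self
    (fun y : Plane => ENNReal.ofReal (Real.exp (-(ρ / Q * ‖y‖ ^ α)))) x,
    ← ofReal_integral_eq_lintegral_ofReal (integrable_exp_neg_mul_norm_rpow hc hα)
      (ae_of_all _ fun _ => (Real.exp_pos _).le), integral_exp_neg_mul_norm_rpow hc hα, Kconst]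

lemma measure_exp_lt {Ω : Type*} [MeasurableSpace Ω] {P : Measure Ω} {h : Ω → ℝ}
    (hm : Measurable h) (hl : HasLaw h (expMeasure 1) P) {a : ℝ} (ha : 0 ≤ a) :
    P {ω | h ω < a} = 1 - ENNReal.ofReal (Real.exp (-a)) := by
  have := isProbabilityMeasure_expMeasure one_pos
  have h1 : P {ω | h ω < a} = expMeasure 1 (Set.Iio a) := by
    rw [← hl.map_eq, Measure.map_apply hm measurableSet_Iio]; rfl
  have h2 : expMeasure 1 (Set.Iio a) = expMeasure 1 (Set.Iic a) := by
    refine measure_congr (Iio_ae_eq_Iic' ?_)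
    simp [expMeasure, gammaMeasure]
  rw [h1, h2, ← ofReal_cdf, cdf_expMeasure_eq one_pos, if_pos ha,
    ENNReal.ofReal_sub _ (Real.exp_pos _).le]
  simp

lemma measure_belowThreshold {Ω : Type*} [MeasurableSpace Ω] {P : Measure Ω}
    [IsProbabilityMeasure P] {h : Ω → ℝ} (hm : Measurable h) (hl : HasLaw h (expMeasure 1) P)
    {α ρ Q : ℝ} (hα : 0 < α) (hρ : 0 < ρ) (hQ : 0 < Q) (x y : Plane) :
    P {ω | Q * h ω / ‖x - y‖ ^ α < ρ} = 1 - exceedProb (ρ / Q) α x y := by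
  by_cases hxy : x = y
  -- For coinciding points the received power is a division by zero, hence `0`, which is below the
  -- threshold; this is why `exceedProb` vanishes on the diagonal.
  · subst hxy
    simp [exceedProb_self, Real.zero_rpow hα.ne', hρ]
  · have hr : 0 < ‖x - y‖ ^ α := Real.rpow_pos_of_pos (norm_pos_iff.2 (sub_ne_zero.2 hxy)) α
    rw [exceedProb_of_ne _ _ hxy, ← measure_exp_lt hm hl (by positivity)]
    congr 1
    ext ω
    simp only [Set.mem_ofPred_eq]
    rw [div_lt_iff₀ hr, div_mul_eq_mul_div, lt_div_iff₀ hQ, mul_comm Q]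

/-! ### The two Poisson functionals evaluated at the exceedance weights. -/

section Functionals

variable {Ω : Type*} [MeasurableSpace Ω] {P : Measure Ω} [IsProbabilityMeasure P]
  {X : ℕ → Ω → MaybePoint} {lam : ℝ}

/-- The probability that the power received over a link stays below the threshold, for points that
may be absent. -/
noncomputable def belowProb (c α : ℝ) (x y : MaybePoint) : ℝ≥0∞ :=
  1 - link (exceedProb c α) x y

lemma belowProb_le_one (c α : ℝ) (x y : MaybePoint) : belowProb c α x y ≤ 1 := tsub_le_self

/-- The weight `-log (1 - s q)`, where `q` is the probability to exceed the threshold. -/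
noncomputable def exceedWeight (c α s : ℝ) (x y : Plane) : ℝ≥0∞ :=
  negLog (1 - ENNReal.ofReal s * exceedProb c α x y)

lemma expNeg_exceedWeight (c α s : ℝ) (x y : Plane) :
    expNeg (exceedWeight c α s x y) = 1 - ENNReal.ofReal s * exceedProb c α x y :=
  expNeg_negLog tsub_le_self

lemma lowerSemicontinuous_exceedWeight (c : ℝ) {α : ℝ} (hα : 0 < α) (s : ℝ) :
    LowerSemicontinuous (Function.uncurry (exceedWeight c α s)) := by
  have h1 : Continuous fun u : ℝ≥0∞ => negLog (1 - ENNReal.ofReal s * u) :=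
    continuous_negLog.comp ((ENNReal.continuous_sub_left (by simp)).comp
      (ENNReal.continuous_const_mul ENNReal.ofReal_ne_top))
  exact h1.comp_lowerSemicontinuous (lowerSemicontinuous_exceedProb c hα) fun u v huv =>
    negLog_antitone (tsub_le_tsub_left (mul_le_mul_right huv _) 1)

lemma negLog_link_exceedProb (c α s : ℝ) (x y : MaybePoint) :
    negLog (1 - ENNReal.ofReal s * link (exceedProb c α) x y) = link (exceedWeight c α s) x y := by
  rcases x with x | u <;> rcases y with y | v <;> simp [link, negLog_one, exceedWeight]

/-- The weight is chosen so that `1 - exp (-weight)` is exactly `s q`. The result does not depend on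
`x`, by translation invariance. -/
lemma lintegral_one_sub_expNeg_exceedWeight {α ρ Q s : ℝ} (hα : 0 < α) (hρ : 0 < ρ) (hQ : 0 < Q)
    (hs : s ≤ 1) (x : Plane) :
    ∫⁻ y, (1 - expNeg (exceedWeight (ρ / Q) α s x y)) =
      ENNReal.ofReal s * ENNReal.ofReal (Kconst α ρ Q) := by
  rw [← lintegral_exceedProb hα hρ hQ x, ← lintegral_const_mul' _ _ ENNReal.ofReal_ne_top]
  refine lintegral_congr fun y => ?_
  rw [expNeg_exceedWeight, ENNReal.sub_sub_cancel (by simp)]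
  exact mul_le_one' (by simpa using hs) (exceedProb_le_one (div_pos hρ hQ) α x y)

/-- The probability that no point of a Poisson point process exceeds the threshold at `x`. -/
lemma IsPPP.lintegral_iprod_belowProb (hX : IsPPP P X lam) (h0 : 0 ≤ lam) {α ρ Q : ℝ}
    (hα : 0 < α) (hρ : 0 < ρ) (hQ : 0 < Q) (x : Plane) :
    ∫⁻ ω, iprod (fun k => belowProb (ρ / Q) α (Sum.inl x) (X k ω)) ∂P =
      ENNReal.ofReal (Real.exp (-(lam * Kconst α ρ Q))) := by
  have hK := Kconst_pos hα hρ hQ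
  have h1 : ∀ ω, iprod (fun k => belowProb (ρ / Q) α (Sum.inl x) (X k ω)) =
      expNeg (∑' k, val (exceedWeight (ρ / Q) α 1 x) (X k ω)) := fun ω => by
    rw [iprod_eq_expNeg fun k => belowProb_le_one _ _ _ _]
    congr 1
    refine tsum_congr fun k => ?_
    have := negLog_link_exceedProb (ρ / Q) α 1 (Sum.inl x) (X k ω)
    rwa [ENNReal.ofReal_one, one_mul] at this
  simp_rw [h1]
  rw [hX.lintegral_expNeg_tsum h0
    (lowerSemicontinuous_exceedWeight (ρ / Q) hα 1).measurable.of_uncurry_left,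
    lintegral_one_sub_expNeg_exceedWeight hα hρ hQ le_rfl, ENNReal.ofReal_one, one_mul,
    ← ENNReal.ofReal_mul h0, expNeg_ofReal (by positivity)]

/-- In the Mecke formula the inner integral is constant in `x`, so the integral over `B` only
contributes its area. -/
lemma IsPPP.campbell_exceedWeight (hX : IsPPP P X lam) (h0 : 0 ≤ lam) {α ρ Q s : ℝ}
    (hα : 0 < α) (hρ : 0 < ρ) (hQ : 0 < Q) (hs0 : 0 ≤ s) (hs : s ≤ 1) {B : Set Plane}
    (hB : MeasurableSet B) (hB' : volume B < ⊤) :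
    campbell P X B (exceedWeight (ρ / Q) α s) =
      ENNReal.ofReal (lam * volume.real B) *
        ENNReal.ofReal (Real.exp (-(lam * Kconst α ρ Q * s))) := by
  have hK := Kconst_pos hα hρ hQ
  have h := hX.meckeFormula h0 hB hB' (lowerSemicontinuous_exceedWeight (ρ / Q) hα s)
  rw [MeckeFormula] at h
  simp_rw [h, lintegral_one_sub_expNeg_exceedWeight hα hρ hQ hs]
  rw [setLIntegral_const, ← ENNReal.ofReal_mul hs0, ← ENNReal.ofReal_mul h0,
    expNeg_ofReal (by positivity), ENNReal.ofReal_mul h0, ofReal_measureReal hB'.ne, mul_assoc,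
    mul_comm (volume B)]
  congr 5
  ring

lemma lintegral_exp_neg_mul_Icc {a : ℝ} (ha : 0 < a) :
    ∫⁻ s in Set.Icc (0 : ℝ) 1, ENNReal.ofReal (Real.exp (-(a * s))) =
      ENNReal.ofReal ((1 - Real.exp (-a)) / a) := by
  have hd : ∀ s : ℝ, HasDerivAt (fun s => -Real.exp (-(a * s)) / a) (Real.exp (-(a * s))) s := by
    intro s
    have h := (((hasDerivAt_id s).const_mul a).neg.exp.neg).div_const a
    convert! h using 1
    simp
    field_simp
  have hc : Continuous fun s : ℝ => Real.exp (-(a * s)) := by fun_prop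
  rw [← ofReal_integral_eq_lintegral_ofReal (hc.continuousOn.integrableOn_Icc)
    (ae_of_all _ fun _ => (Real.exp_pos _).le), integral_Icc_eq_integral_Ioc,
    ← intervalIntegral.integral_of_le zero_le_one,
    intervalIntegral.integral_eq_sub_of_hasDerivAt (fun s _ => hd s) (hc.intervalIntegrable 0 1)]
  congr 1
  simp
  ring

end Functionals

/-- Freezing: by independence one variable may be held fixed while the mean over the other is taken.
-/
lemma ProbabilityTheory.IndepFun.lintegral_comp {Ω α β : Type*} [MeasurableSpace Ω]
    [MeasurableSpace α] [MeasurableSpace β] {P : Measure Ω} [IsProbabilityMeasure P]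
    {X : Ω → α} {W : Ω → β} (h : IndepFun X W P) (hX : Measurable X) (hW : Measurable W)
    {F : α → β → ℝ≥0∞} (hF : Measurable (Function.uncurry F)) :
    ∫⁻ ω, F (X ω) (W ω) ∂P = ∫⁻ ω, ∫⁻ ω', F (X ω) (W ω') ∂P ∂P := by
  have := Measure.isProbabilityMeasure_map (μ := P) hW.aemeasurable
  have h1 := lintegral_map (μ := P) hF (hX.prodMk hW)
  rw [h.map_prod_eq_prod_map_map hX.aemeasurable hW.aemeasurable,
    lintegral_prod _ hF.aemeasurable, lintegral_map hF.lintegral_prod_right' hX] at h1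
  simp only [Function.uncurry] at h1
  rw [← h1]
  exact lintegral_congr fun ω => lintegral_map (hF.of_uncurry_left) hW

/-! ### The retention indicator as a conjunction of threshold and timer conditions. -/

lemma ind_mul (p q : Prop) : ind p * ind q = ind (p ∧ q) := by
  by_cases hp : p <;> by_cases hq : q <;> simp [ind, hp, hq]

lemma ind_eq_one_iff (p : Prop) : ind p = 1 ↔ p := by
  by_cases hp : p <;> simp [ind, hp]

lemma ind_add_ind_mul {a b : ℝ} (p : Prop) : ind (a ≤ b) + ind (a > b) * ind p =
    ind (a ≤ b ∨ p) := by
  by_cases h : a ≤ b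
  · simp [ind, h]
  · by_cases hp : p <;> simp [ind, hp, h, not_le.1 h]

lemma tprod_ind {ι : Type*} (p : ι → Prop) : ∏' j, ind (p j) = ind (∀ j, p j) := by
  classical
  by_cases h : ∀ j, p j
  · simp [ind, h]
  · obtain ⟨j, hj⟩ := not_forall.1 h
    have h0 : ind (p j) = 0 := by simp [ind, hj]
    -- Every finite product containing the index `j` vanishes, so the unconditional product
    -- converges to `0`.
    have : HasProd (fun j => ind (p j)) 0 := by
      refine tendsto_const_nhds.congr' ?_
      filter_upwards [eventually_ge_atTop {j}] with s hs
      exact (Finset.prod_eq_zero (hs (Finset.mem_singleton_self j)) h0).symm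
    rw [this.tprod_eq]
    simp [ind, h]

lemma Network.U_eq_one_iff {Ω : Type*} (N : Network Ω) (Q α ρs ρd : ℝ) (i : ℕ) (ω : Ω) :
    N.U Q α ρs ρd i ω = 1 ↔
      ((∀ j, BelowThreshold Q α ρs (N.hY (i, j) ω) (N.T i ω) (N.Y j ω)) ∧
        ∀ l, BelowThreshold Q α ρs (N.hZ (i, l) ω) (N.T i ω) (N.Z l ω)) ∧
        ∀ k, k = i ∨ N.t i ω ≤ N.t k ω ∨
          BelowThreshold Q α ρd (N.hT s(i, k) ω) (N.T i ω) (N.T k ω) := by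
  simp_rw [Network.U, ind_add_ind_mul, tprod_ind, ind_mul, ind_eq_one_iff, Subtype.forall,
    or_iff_not_imp_left (a := _ = i)]

open Classical in
/-- The indicator of `BelowThreshold`, with values in `ℝ≥0∞`. -/
noncomputable def belowInd (Q α ρ h : ℝ) (x y : MaybePoint) : ℝ≥0∞ :=
  if BelowThreshold Q α ρ h x y then 1 else 0

lemma measurableSet_belowThreshold (Q α ρ : ℝ) :
    MeasurableSet {p : ℝ × MaybePoint × MaybePoint | BelowThreshold Q α ρ p.1 p.2.1 p.2.2} := by
  have h : {p : ℝ × MaybePoint × MaybePoint | BelowThreshold Q α ρ p.1 p.2.1 p.2.2} =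
      {p | Q * p.1 / ‖point p.2.1 - point p.2.2‖ ^ α < ρ} ∪
        ({p | p.2.1 ∈ Set.range Sum.inr} ∪ {p | p.2.2 ∈ Set.range Sum.inr}) := by
    ext ⟨h, x, y⟩
    rcases x with x | x <;> rcases y with y | y <;> simp [BelowThreshold, point]
  rw [h]
  have hp := measurable_point
  have hr : MeasurableSet (Set.range (Sum.inr : Unit → MaybePoint)) := measurableSet_range_inr
  refine (measurableSet_lt (by fun_prop) measurable_const).union
    ((hr.preimage measurable_snd.fst).union (hr.preimage measurable_snd.snd))

@[fun_prop]
lemma Measurable.belowInd {β : Type*} [MeasurableSpace β] {Q α ρ : ℝ} {h : β → ℝ}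
    {x y : β → MaybePoint} (hh : Measurable h) (hx : Measurable x) (hy : Measurable y) :
    Measurable fun b => belowInd Q α ρ (h b) (x b) (y b) := by
  classical
  exact Measurable.ite ((measurableSet_belowThreshold Q α ρ).preimage
    (hh.prodMk (hx.prodMk hy))) measurable_const measurable_const

lemma belowInd_le_one (Q α ρ h : ℝ) (x y : MaybePoint) : belowInd Q α ρ h x y ≤ 1 := by
  unfold belowInd; split_ifs <;> simp

/-! ### Averages over the fadings and the timers, given the positions. -/

section Model

variable {Ω : Type*} [MeasurableSpace Ω] {P : Measure Ω} [IsProbabilityMeasure P]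

lemma lintegral_belowInd {h : Ω → ℝ} (hm : Measurable h) (hl : HasLaw h (expMeasure 1) P)
    {α ρ Q : ℝ} (hα : 0 < α) (hρ : 0 < ρ) (hQ : 0 < Q) (x y : MaybePoint) :
    ∫⁻ ω, belowInd Q α ρ (h ω) x y ∂P = belowProb (ρ / Q) α x y := by
  classical
  have h1 : ∫⁻ ω, belowInd Q α ρ (h ω) x y ∂P = P {ω | BelowThreshold Q α ρ (h ω) x y} := by
    have hs : MeasurableSet {ω | BelowThreshold Q α ρ (h ω) x y} :=
      (measurableSet_belowThreshold Q α ρ).preimage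
        (hm.prodMk (measurable_const (a := (x, y))))
    rw [← lintegral_indicator_one hs]
    refine lintegral_congr fun ω => ?_
    simp [belowInd, Set.indicator_apply]
  rw [h1, belowProb]
  rcases x with x | x <;> rcases y with y | y <;> simp [BelowThreshold, link]
  exact measure_belowThreshold hm hl hα hρ hQ x y

/-- The probability that a transmitter at `x` does not exceed the threshold at any of the points
of an independent Poisson point process. -/
lemma lintegral_iprod_belowInd {X : ℕ → Ω → MaybePoint} {lam : ℝ} (hX : IsPPP P X lam)
    (h0 : 0 ≤ lam) {h : ℕ × ℕ → Ω → ℝ} (hm : ∀ e, Measurable (h e))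
    (hl : ∀ e, HasLaw (h e) (expMeasure 1) P) (hi : iIndepFun h P)
    (hXh : IndepFun (fun ω n => X n ω) (fun ω e => h e ω) P)
    {α ρ Q : ℝ} (hα : 0 < α) (hρ : 0 < ρ) (hQ : 0 < Q) (i : ℕ) (x : Plane) :
    ∫⁻ ω, iprod (fun j => belowInd Q α ρ (h (i, j) ω) (Sum.inl x) (X j ω)) ∂P =
      ENNReal.ofReal (Real.exp (-(lam * Kconst α ρ Q))) := by
  have hXm := hX.measurable
  rw [hXh.lintegral_comp (by fun_prop) (by fun_prop)
    (F := fun y η => iprod fun j => belowInd Q α ρ (η (i, j)) (Sum.inl x) (y j)),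
    ← hX.lintegral_iprod_belowProb h0 hα hρ hQ x]
  · refine lintegral_congr fun ω => ?_
    have hi' : iIndepFun (fun j => h (i, j)) P := hi.precomp (Prod.mk_right_injective i)
    rw [lintegral_iprod (by fun_prop) (fun _ _ => belowInd_le_one _ _ _ _ _ _)
      (hi'.comp (fun j η => belowInd Q α ρ η (Sum.inl x) (X j ω)) (by fun_prop))]
    simp_rw [lintegral_belowInd (hm _) (hl _) hα hρ hQ]
  · exact measurable_iprod fun j => by fun_prop

open Classical in
/-- The indicator that the competitor `k` does not prevent the transmission of `i`, as a function
of their timers and of the indicator that they are not in contention. -/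
noncomputable def timerFactor (i k : ℕ) (s t : ℝ) (b : ℝ≥0∞) : ℝ≥0∞ :=
  if k = i ∨ s ≤ t then 1 else b

lemma timerFactor_le_one {i k : ℕ} {s t : ℝ} {b : ℝ≥0∞} (hb : b ≤ 1) :
    timerFactor i k s t b ≤ 1 := by
  unfold timerFactor; split_ifs <;> simp [hb]

@[fun_prop]
lemma Measurable.timerFactor {β : Type*} [MeasurableSpace β] {i k : ℕ} {s t : β → ℝ}
    {b : β → ℝ≥0∞} (hs : Measurable s) (ht : Measurable t) (hb : Measurable b) :
    Measurable fun a => timerFactor i k (s a) (t a) (b a) := by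
  classical
  exact Measurable.ite ((MeasurableSet.const _).union (measurableSet_le hs ht))
    measurable_const hb

/-- The competitor blocks when its timer is below `s`, of probability `s`, and the link exceeds the
threshold, of probability `q`. -/
lemma lintegral_timerFactor {t : Ω → ℝ} (hm : Measurable t)
    (hl : HasLaw t (volume.restrict (Set.Icc (0 : ℝ) 1)) P) {s : ℝ} (hs : s ∈ Set.Icc (0 : ℝ) 1)
    {q : ℝ≥0∞} (hq : q ≤ 1) (i k : ℕ) :
    ∫⁻ ω, timerFactor i k s (t ω) (1 - q) ∂P =
      1 - if k = i then 0 else ENNReal.ofReal s * q := by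
  classical
  by_cases hk : k = i
  · simp [timerFactor, hk]
  · have h1 : ∀ ω, timerFactor i k s (t ω) (1 - q) = 1 - {ω | t ω < s}.indicator (fun _ => q) ω := by
      intro ω
      by_cases h : s ≤ t ω
      · simp [timerFactor, h]
      · simp [timerFactor, h, hk, not_le.1 h]
    have hms : MeasurableSet {ω | t ω < s} := measurableSet_lt hm measurable_const
    have hP : P {ω | t ω < s} = ENNReal.ofReal s := by
      have : P {ω | t ω < s} = volume.restrict (Set.Icc (0 : ℝ) 1) (Set.Iio s) := by
        rw [← hl.map_eq, Measure.map_apply hm measurableSet_Iio]; rfl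
      rw [this, Measure.restrict_apply measurableSet_Iio,
        show Set.Iio s ∩ Set.Icc 0 1 = Set.Ico 0 s by
          ext u; simp only [Set.mem_inter_iff, Set.mem_Iio, Set.mem_Icc, Set.mem_Ico]
          exact ⟨fun h => ⟨h.2.1, h.1⟩, fun h => ⟨h.2, h.1, (h.2.trans_le hs.2).le⟩⟩]
      simp
    simp_rw [h1, hk, if_false]
    rw [lintegral_sub (measurable_const.indicator hms)]
    · rw [lintegral_indicator_const hms, hP]
      simp [mul_comm]
    · rw [lintegral_indicator_const hms]
      exact (ENNReal.mul_lt_top (hq.trans_lt (by simp)) (measure_lt_top _ _)).ne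
    · refine ae_of_all _ fun ω => ?_
      exact Set.indicator_le (fun _ _ => hq) ω

/-- Overwriting coordinate `i` by a constant keeps the index set `ℕ` while removing the dependence
on `t i`. -/
lemma ProbabilityTheory.iIndepFun.indepFun_update {Ω : Type*} [MeasurableSpace Ω] {P : Measure Ω}
    {t : ℕ → Ω → ℝ} (hti : iIndepFun t P)
    (htm : ∀ k, Measurable (t k)) (i : ℕ) :
    IndepFun (t i) (fun ω => Function.update (fun k => t k ω) i 0) P := by
  have h := indep_iSup_of_disjoint (fun k => (htm k).comap_le) hti
    (S := {i}) (T := {i}ᶜ) disjoint_compl_right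
  refine indep_of_indep_of_le_left (indep_of_indep_of_le_right h ?_) ?_
  · rw [← measurable_iff_comap_le]
    refine @measurable_pi_lambda _ _ _ (_) _ _ fun k => ?_
    by_cases hk : k = i
    · subst hk
      simp only [Function.update_self]
      exact measurable_const
    · simp only [Function.update_of_ne hk]
      exact (comap_measurable (t k)).mono (le_iSup₂_of_le k hk le_rfl) le_rfl
  · exact le_iSup₂_of_le i rfl le_rfl

/-- The probability that `i` is not prevented from transmitting by the other transmitters, given
the positions `τ` of all transmitters. -/
lemma lintegral_iprod_timerFactor {h : Sym2 ℕ → Ω → ℝ} {t : ℕ → Ω → ℝ}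
    (hm : ∀ e, Measurable (h e)) (hl : ∀ e, HasLaw (h e) (expMeasure 1) P) (hi : iIndepFun h P)
    (htm : ∀ k, Measurable (t k))
    (htl : ∀ k, HasLaw (t k) (volume.restrict (Set.Icc (0 : ℝ) 1)) P) (hti : iIndepFun t P)
    (hth : IndepFun (fun ω n => t n ω) (fun ω e => h e ω) P)
    {α ρ Q : ℝ} (hα : 0 < α) (hρ : 0 < ρ) (hQ : 0 < Q) (i : ℕ) (τ : ℕ → MaybePoint) :
    ∫⁻ ω, iprod (fun k => timerFactor i k (t i ω) (t k ω)
        (belowInd Q α ρ (h s(i, k) ω) (τ i) (τ k))) ∂P =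
      ∫⁻ s in Set.Icc (0 : ℝ) 1,
        expNeg (∑' k, if k = i then 0 else link (exceedWeight (ρ / Q) α s) (τ i) (τ k)) := by
  classical
  have hq : ∀ x y, link (exceedProb (ρ / Q) α) x y ≤ 1 := fun x y => by
    rcases x with x | x <;> rcases y with y | y <;>
      simp [link, exceedProb_le_one (div_pos hρ hQ)]
  rw [hth.lintegral_comp (by fun_prop) (by fun_prop)
    (F := fun u η => iprod fun k => timerFactor i k (u i) (u k)
      (belowInd Q α ρ (η s(i, k)) (τ i) (τ k)))]
  swap
  · exact measurable_iprod fun j => by fun_prop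
  have h1 : ∀ ω, ∫⁻ ω', iprod (fun k => timerFactor i k (t i ω) (t k ω)
        (belowInd Q α ρ (h s(i, k) ω') (τ i) (τ k))) ∂P =
      iprod fun k => timerFactor i k (t i ω) (t k ω) (belowProb (ρ / Q) α (τ i) (τ k)) := by
    intro ω
    -- Channels are reciprocal, but the links from a fixed `i` are distinct unordered pairs, so
    -- their fadings are independent.
    have hinj : Function.Injective fun k : ℕ => s(i, k) := fun a b hab =>
      Sym2.congr_right.1 hab
    have hi' : iIndepFun (fun k => h s(i, k)) P := hi.precomp hinj
    rw [lintegral_iprod (by fun_prop)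
      (fun _ _ => timerFactor_le_one (belowInd_le_one _ _ _ _ _ _))
      (hi'.comp (fun k η => timerFactor i k (t i ω) (t k ω) (belowInd Q α ρ η (τ i) (τ k)))
        (by fun_prop))]
    congr 1
    ext k
    unfold timerFactor
    split_ifs
    · simp
    · exact lintegral_belowInd (hm _) (hl _) hα hρ hQ _ _
  simp_rw [h1]
  -- The factor at `k = i` equals `1` whatever the timers, so overwriting that coordinate changes
  -- nothing.
  have h2 : ∀ ω ω', iprod (fun k => timerFactor i k (t i ω) (t k ω')
      (belowProb (ρ / Q) α (τ i) (τ k))) =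
      iprod fun k => timerFactor i k (t i ω) (Function.update (fun k => t k ω') i 0 k)
        (belowProb (ρ / Q) α (τ i) (τ k)) := fun ω ω' => by
    congr 1
    ext k
    by_cases hk : k = i
    · simp [timerFactor, hk]
    · rw [Function.update_of_ne hk]
  have hmF : Measurable fun p : ℝ × (ℕ → ℝ) => iprod fun k => timerFactor i k p.1 (p.2 k)
      (belowProb (ρ / Q) α (τ i) (τ k)) := measurable_iprod fun j => by fun_prop
  calc _ = ∫⁻ ω, ∫⁻ ω', iprod (fun k => timerFactor i k (t i ω) (t k ω')
        (belowProb (ρ / Q) α (τ i) (τ k))) ∂P ∂P := by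
        simp_rw [h2]
        exact (hti.indepFun_update htm i).lintegral_comp (htm i) (by fun_prop)
          (F := fun u v => iprod fun k => timerFactor i k u (v k)
            (belowProb (ρ / Q) α (τ i) (τ k))) hmF
    _ = ∫⁻ s in Set.Icc (0 : ℝ) 1, ∫⁻ ω', iprod (fun k => timerFactor i k s (t k ω')
        (belowProb (ρ / Q) α (τ i) (τ k))) ∂P := by
        rw [← (htl i).map_eq, lintegral_map _ (htm i)]
        have hmt : Measurable fun p : ℝ × Ω => (p.1, fun k => t k p.2) := by fun_prop
        exact (hmF.comp hmt).lintegral_prod_right'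
    _ = _ := by
        refine setLIntegral_congr_fun measurableSet_Icc fun s hs => ?_
        rw [lintegral_iprod (by fun_prop) (fun _ _ => timerFactor_le_one (belowProb_le_one _ _ _ _))
          (hti.comp (fun k u => timerFactor i k s u (belowProb (ρ / Q) α (τ i) (τ k)))
            (by fun_prop))]
        simp only [belowProb]
        simp_rw [lintegral_timerFactor (htm _) (htl _) hs (hq _ _)]
        rw [iprod_eq_expNeg fun k => tsub_le_self]
        congr 1
        refine tsum_congr fun k => ?_
        by_cases hk : k = i
        · simp [hk, negLog_one]
        · simp only [hk, if_false]
          exact negLog_link_exceedProb _ _ _ _ _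

end Model

/-! ### Density of the transmitters retained by the CSMA scheme. -/

section Density

variable {Ω : Type*} [mΩ : MeasurableSpace Ω] {P : Measure Ω} {N : Network Ω} {lamY lamZ lamT : ℝ}

/-- The σ-algebras generated by the seven families of random objects of the network. -/
abbrev Network.sigma {Ω : Type*} (N : Network Ω) : Fin 7 → MeasurableSpace Ω :=
  ![MeasurableSpace.comap (fun ω n => N.Y n ω) inferInstance,
    MeasurableSpace.comap (fun ω n => N.Z n ω) inferInstance,
    MeasurableSpace.comap (fun ω n => N.T n ω) inferInstance,
    MeasurableSpace.comap (fun ω e => N.hY e ω) inferInstance,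
    MeasurableSpace.comap (fun ω e => N.hZ e ω) inferInstance,
    MeasurableSpace.comap (fun ω e => N.hT e ω) inferInstance,
    MeasurableSpace.comap (fun ω i => N.t i ω) inferInstance]

lemma Network.IsModel.sigma_le (hN : N.IsModel P lamY lamZ lamT) (i : Fin 7) :
    N.sigma i ≤ mΩ := by
  have h1 := hN.pppY.measurable
  have h2 := hN.pppZ.measurable
  have h3 := hN.pppT.measurable
  have h4 := hN.meas_hY
  have h5 := hN.meas_hZ
  have h6 := hN.meas_hT
  have h7 := hN.meas_t
  fin_cases i <;> exact Measurable.comap_le (by fun_prop)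

lemma measurable_comap_iSup {Ω β : Type*} {N : Network Ω} [MeasurableSpace β] {f : Ω → β} {S : Set (Fin 7)}
    {i : Fin 7} (hi : i ∈ S) (hf : N.sigma i = MeasurableSpace.comap f inferInstance) :
    Measurable[⨆ i ∈ S, N.sigma i] f :=
  (comap_measurable f).mono (hf.symm.le.trans (le_iSup₂_of_le i hi le_rfl)) le_rfl

lemma Network.IsModel.indepFun (hN : N.IsModel P lamY lamZ lamT) {β γ : Type*}
    [MeasurableSpace β] [MeasurableSpace γ] {f : Ω → β} {g : Ω → γ} (S T : Set (Fin 7))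
    (hST : Disjoint S T) (hf : Measurable[⨆ i ∈ S, N.sigma i] f)
    (hg : Measurable[⨆ i ∈ T, N.sigma i] g) : IndepFun f g P := by
  have h : iIndep N.sigma P := hN.indep
  exact (IndepFun_iff_Indep f g P).2 (indep_of_indep_of_le_left (indep_of_indep_of_le_right
    (indep_iSup_of_disjoint hN.sigma_le h hST) (measurable_iff_comap_le.1 hg))
    (measurable_iff_comap_le.1 hf))

lemma val_retained {Ω : Type*} (X : ℕ → Ω → MaybePoint) (U : ℕ → Ω → ℝ) (g : Plane → ℝ≥0∞) (i : ℕ) (ω : Ω)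
    [Decidable (U i ω = 1)] :
    val g (retained X U i ω) = val g (X i ω) * if U i ω = 1 then 1 else 0 := by
  by_cases h : U i ω = 1 <;> simp [retained, h]

/-- The indicator of retention is a product of indicators. -/
lemma Network.indicator_U_eq {Ω : Type*} (N : Network Ω) (Q α ρs ρd : ℝ) (i : ℕ) (ω : Ω)
    [Decidable (N.U Q α ρs ρd i ω = 1)] :
    (if N.U Q α ρs ρd i ω = 1 then 1 else 0 : ℝ≥0∞) =
      iprod (fun j => belowInd Q α ρs (N.hY (i, j) ω) (N.T i ω) (N.Y j ω)) *
      (iprod (fun j => belowInd Q α ρs (N.hZ (i, j) ω) (N.T i ω) (N.Z j ω)) *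
      iprod (fun k => timerFactor i k (N.t i ω) (N.t k ω)
        (belowInd Q α ρd (N.hT s(i, k) ω) (N.T i ω) (N.T k ω)))) := by
  classical
  have ht : ∀ k, timerFactor i k (N.t i ω) (N.t k ω)
      (belowInd Q α ρd (N.hT s(i, k) ω) (N.T i ω) (N.T k ω)) =
      if k = i ∨ N.t i ω ≤ N.t k ω ∨
        BelowThreshold Q α ρd (N.hT s(i, k) ω) (N.T i ω) (N.T k ω) then 1 else 0 := by
    intro k
    unfold timerFactor belowInd
    by_cases h1 : k = i <;> by_cases h2 : N.t i ω ≤ N.t k ω <;> simp [h1, h2]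
  simp_rw [ht]
  unfold belowInd
  rw [iprod_indicator, iprod_indicator, iprod_indicator, ← mul_assoc]
  simp only [N.U_eq_one_iff]
  by_cases h1 : ∀ j, BelowThreshold Q α ρs (N.hY (i, j) ω) (N.T i ω) (N.Y j ω) <;>
  by_cases h2 : ∀ j, BelowThreshold Q α ρs (N.hZ (i, j) ω) (N.T i ω) (N.Z j ω) <;>
  simp [h1, h2]

/-- Joint measurability in the outcome and the timer value permits exchanging their integrals. -/
lemma measurable_campbell_time {X : ℕ → Ω → MaybePoint} (hX : ∀ n, Measurable (X n)) (c : ℝ)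
    {α : ℝ} (hα : 0 < α) {B : Set Plane} (hB : MeasurableSet B) (i : ℕ) :
    Measurable fun p : Ω × ℝ => val (B.indicator 1) (X i p.1) *
      expNeg (∑' k, if k = i then 0 else link (exceedWeight c α p.2) (X i p.1) (X k p.1)) := by
  refine ((measurable_val (measurable_one.indicator hB)).comp ((hX i).comp measurable_fst)).mul
    (measurable_expNeg.comp (Measurable.tsum fun k => ?_))
  split_ifs
  · exact measurable_const
  · simp_rw [← negLog_link_exceedProb]
    exact measurable_negLog.comp (measurable_const.sub
      ((ENNReal.measurable_ofReal.comp measurable_snd).mul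
        ((measurable_link (measurable_exceedProb c hα)).comp
          (((hX i).comp measurable_fst).prodMk ((hX k).comp measurable_fst)))))

lemma Network.IsModel.indepFun_T (hN : N.IsModel P lamY lamZ lamT) :
    IndepFun (fun ω n => N.T n ω) (fun ω => ((fun n => N.Y n ω, fun e => N.hY e ω),
      (fun n => N.Z n ω, fun e => N.hZ e ω), (fun e => N.hT e ω, fun n => N.t n ω))) P := by
  refine hN.indepFun {2} {0, 1, 3, 4, 5, 6} (by simp) (measurable_comap_iSup rfl rfl) ?_
  refine Measurable.prodMk (Measurable.prodMk ?_ ?_) (Measurable.prodMk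
    (Measurable.prodMk ?_ ?_) (Measurable.prodMk ?_ ?_))
  · exact measurable_comap_iSup (i := 0) (by simp) rfl
  · exact measurable_comap_iSup (i := 3) (by simp) rfl
  · exact measurable_comap_iSup (i := 1) (by simp) rfl
  · exact measurable_comap_iSup (i := 4) (by simp) rfl
  · exact measurable_comap_iSup (i := 5) (by simp) rfl
  · exact measurable_comap_iSup (i := 6) (by simp) rfl

lemma Network.IsModel.indepFun_Y_hY (hN : N.IsModel P lamY lamZ lamT) :
    IndepFun (fun ω => ((fun n => N.Y n ω, fun e => N.hY e ω) :
      (ℕ → MaybePoint) × (ℕ × ℕ → ℝ)))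
      (fun ω => ((fun n => N.Z n ω, fun e => N.hZ e ω),
        (fun e => N.hT e ω, fun n => N.t n ω))) P := by
  refine hN.indepFun {0, 3} {1, 4, 5, 6} (by simp) (Measurable.prodMk ?_ ?_)
    (Measurable.prodMk (Measurable.prodMk ?_ ?_) (Measurable.prodMk ?_ ?_))
  · exact measurable_comap_iSup (i := 0) (by simp) rfl
  · exact measurable_comap_iSup (i := 3) (by simp) rfl
  · exact measurable_comap_iSup (i := 1) (by simp) rfl
  · exact measurable_comap_iSup (i := 4) (by simp) rfl
  · exact measurable_comap_iSup (i := 5) (by simp) rfl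
  · exact measurable_comap_iSup (i := 6) (by simp) rfl

lemma Network.IsModel.indepFun_Z_hZ (hN : N.IsModel P lamY lamZ lamT) :
    IndepFun (fun ω => ((fun n => N.Z n ω, fun e => N.hZ e ω) :
      (ℕ → MaybePoint) × (ℕ × ℕ → ℝ)))
      (fun ω => ((fun e => N.hT e ω, fun n => N.t n ω) : (Sym2 ℕ → ℝ) × (ℕ → ℝ))) P := by
  refine hN.indepFun {1, 4} {5, 6} (by simp) (Measurable.prodMk ?_ ?_) (Measurable.prodMk ?_ ?_)
  · exact measurable_comap_iSup (i := 1) (by simp) rfl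
  · exact measurable_comap_iSup (i := 4) (by simp) rfl
  · exact measurable_comap_iSup (i := 5) (by simp) rfl
  · exact measurable_comap_iSup (i := 6) (by simp) rfl

variable [IsProbabilityMeasure P]

/-- With `X` frozen, the three remaining factors depend on independent variables and their means
multiply. `X` is to be the transmitter positions, on which all factors depend. -/
lemma ProbabilityTheory.IndepFun.lintegral_mul_mul {β₀ β₁ β₂ β₃ : Type*} [MeasurableSpace β₀]
    [MeasurableSpace β₁] [MeasurableSpace β₂] [MeasurableSpace β₃] {X : Ω → β₀} {A : Ω → β₁}
    {B : Ω → β₂} {C : Ω → β₃} (hX : Measurable X) (hA : Measurable A) (hB : Measurable B)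
    (hC : Measurable C) (h0 : IndepFun X (fun ω => (A ω, B ω, C ω)) P)
    (h1 : IndepFun A (fun ω => (B ω, C ω)) P) (h2 : IndepFun B C P) {e : β₀ → ℝ≥0∞}
    (he : Measurable e) (he' : ∀ x, e x ≠ ⊤) {f : β₀ → β₁ → ℝ≥0∞} {g : β₀ → β₂ → ℝ≥0∞}
    {k : β₀ → β₃ → ℝ≥0∞} (hf : Measurable (Function.uncurry f))
    (hg : Measurable (Function.uncurry g)) (hk : Measurable (Function.uncurry k)) :
    ∫⁻ ω, e (X ω) * (f (X ω) (A ω) * (g (X ω) (B ω) * k (X ω) (C ω))) ∂P =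
      ∫⁻ ω, e (X ω) * ((∫⁻ ω', f (X ω) (A ω') ∂P) * ((∫⁻ ω', g (X ω) (B ω') ∂P) *
        ∫⁻ ω', k (X ω) (C ω') ∂P)) ∂P := by
  have hF : Measurable (Function.uncurry fun (x : β₀) (p : β₁ × β₂ × β₃) =>
      e x * (f x p.1 * (g x p.2.1 * k x p.2.2))) := by
    refine (he.comp measurable_fst).mul (Measurable.mul ?_ (Measurable.mul ?_ ?_))
    · exact hf.comp (measurable_fst.prodMk measurable_snd.fst)
    · exact hg.comp (measurable_fst.prodMk measurable_snd.snd.fst)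
    · exact hk.comp (measurable_fst.prodMk measurable_snd.snd.snd)
  refine (h0.lintegral_comp hX (hA.prodMk (hB.prodMk hC)) hF).trans ?_
  refine lintegral_congr fun ω => ?_
  have mf : Measurable (f (X ω)) := hf.of_uncurry_left
  have mg : Measurable (g (X ω)) := hg.of_uncurry_left
  have mk : Measurable (k (X ω)) := hk.of_uncurry_left
  have a1 : IndepFun (fun ω' => f (X ω) (A ω')) (fun ω' => g (X ω) (B ω') * k (X ω) (C ω')) P :=
    h1.comp mf (ψ := fun p : β₂ × β₃ => g (X ω) p.1 * k (X ω) p.2)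
      ((mg.comp measurable_fst).mul (mk.comp measurable_snd))
  have a2 : IndepFun (fun ω' => g (X ω) (B ω')) (fun ω' => k (X ω) (C ω')) P := h2.comp mg mk
  have b1 : AEMeasurable (fun ω' => f (X ω) (A ω')) P := (mf.comp hA).aemeasurable
  have b2 : AEMeasurable (fun ω' => g (X ω) (B ω')) P := (mg.comp hB).aemeasurable
  have b3 : AEMeasurable (fun ω' => k (X ω) (C ω')) P := (mk.comp hC).aemeasurable
  rw [lintegral_const_mul' _ _ (he' _),
    ← lintegral_mul_eq_lintegral_mul_lintegral_of_indepFun'' b2 b3 a2]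
  congr 1
  exact lintegral_mul_eq_lintegral_mul_lintegral_of_indepFun'' b1 (b2.mul b3) a1

/-- The mean of the contribution of the transmitter `i` to the number of retained points in `B`. -/
lemma Network.IsModel.lintegral_val_retained (hN : N.IsModel P lamY lamZ lamT)
    {α Q ρs ρd : ℝ} (hα : 0 < α) (hQ : 0 < Q) (hρs : 0 < ρs) (hρd : 0 < ρd)
    (hlamY : 0 ≤ lamY) (hlamZ : 0 ≤ lamZ) {B : Set Plane} (hB : MeasurableSet B) (i : ℕ) :
    ∫⁻ ω, val (B.indicator 1) (retained N.T (N.U Q α ρs ρd) i ω) ∂P =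
      ENNReal.ofReal (Real.exp (-(lamY + lamZ) * Kconst α ρs Q)) *
      ∫⁻ ω, (∫⁻ s in Set.Icc (0 : ℝ) 1, val (B.indicator 1) (N.T i ω) *
        expNeg (∑' k, if k = i then 0 else
          link (exceedWeight (ρd / Q) α s) (N.T i ω) (N.T k ω))) ∂P := by
  classical
  have m1 := hN.pppY.measurable
  have m2 := hN.pppZ.measurable
  have m3 := hN.pppT.measurable
  have m4 := hN.meas_hY
  have m5 := hN.meas_hZ
  have m6 := hN.meas_hT
  have m7 := hN.meas_t
  have iYh : IndepFun (fun ω n => N.Y n ω) (fun ω e => N.hY e ω) P :=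
    hN.indepFun {0} {3} (by simp) (measurable_comap_iSup rfl rfl) (measurable_comap_iSup rfl rfl)
  have iZh : IndepFun (fun ω n => N.Z n ω) (fun ω e => N.hZ e ω) P :=
    hN.indepFun {1} {4} (by simp) (measurable_comap_iSup rfl rfl) (measurable_comap_iSup rfl rfl)
  have ith : IndepFun (fun ω n => N.t n ω) (fun ω e => N.hT e ω) P :=
    hN.indepFun {6} {5} (by simp) (measurable_comap_iSup rfl rfl) (measurable_comap_iSup rfl rfl)
  have hval := measurable_val (measurable_one.indicator hB)
  have hfin := fun x => ne_top_of_le_ne_top ENNReal.one_ne_top (val_indicator_one_le B x)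
  have key := IndepFun.lintegral_mul_mul (by fun_prop) (by fun_prop) (by fun_prop) (by fun_prop)
    hN.indepFun_T hN.indepFun_Y_hY hN.indepFun_Z_hZ
    (e := fun τ => val (B.indicator 1) (τ i)) (hval.comp (measurable_pi_apply i))
    (fun τ => hfin (τ i))
    (f := fun τ p => iprod fun j => belowInd Q α ρs (p.2 (i, j)) (τ i) (p.1 j))
    (g := fun τ p => iprod fun j => belowInd Q α ρs (p.2 (i, j)) (τ i) (p.1 j))
    (k := fun τ p => iprod fun k => timerFactor i k (p.2 i) (p.2 k)
      (belowInd Q α ρd (p.1 s(i, k)) (τ i) (τ k)))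
    (measurable_iprod fun j => by fun_prop) (measurable_iprod fun j => by fun_prop)
    (measurable_iprod fun j => by fun_prop)
  simp_rw [val_retained, N.indicator_U_eq]
  refine key.trans ?_
  rw [← lintegral_const_mul' _ _ ENNReal.ofReal_ne_top]
  refine lintegral_congr fun ω => ?_
  rw [lintegral_const_mul' _ _ (hfin _)]
  rcases hx : N.T i ω with x | u
  swap
  · simp [hx]
  have e4 := lintegral_iprod_timerFactor m6 hN.law_hT hN.iid_hT m7 hN.law_t hN.iid_t ith
    hα hρd hQ i fun n => N.T n ω
  simp only [hx] at e4 ⊢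
  rw [lintegral_iprod_belowInd hN.pppY hlamY m4 hN.law_hY hN.iid_hY iYh hα hρs hQ i x,
    lintegral_iprod_belowInd hN.pppZ hlamZ m5 hN.law_hZ hN.iid_hZ iZh hα hρs hQ i x, e4,
    ← mul_assoc (ENNReal.ofReal _), ← ENNReal.ofReal_mul (Real.exp_pos _).le, ← Real.exp_add,
    mul_left_comm]
  congr 3
  ring_nf

/-- The density of the transmitters retained by the CSMA scheme. -/
theorem Network.IsModel.hasDensity_retained (hN : N.IsModel P lamY lamZ lamT)
    {α Q ρs ρd : ℝ} (hα : 0 < α) (hQ : 0 < Q) (hρs : 0 < ρs) (hρd : 0 < ρd)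
    (hlamY : 0 ≤ lamY) (hlamZ : 0 ≤ lamZ) (hlamT : 0 < lamT) :
    HasDensity P (retained N.T (N.U Q α ρs ρd))
      (Real.exp (-(lamY + lamZ) * Kconst α ρs Q) *
        ((1 - Real.exp (-(lamT * Kconst α ρd Q))) / Kconst α ρd Q)) := by
  intro B hB hB'
  have hK := Kconst_pos hα hρd hQ
  have hT := hN.pppT.measurable
  have hm := fun i => measurable_campbell_time hT (ρd / Q) hα hB i
  have hU : ∀ i, Measurable fun ω => val (B.indicator 1) (retained N.T (N.U Q α ρs ρd) i ω) := by
    classical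
    intro i
    have m1 := hN.pppY.measurable
    have m2 := hN.pppZ.measurable
    have m4 := hN.meas_hY
    have m5 := hN.meas_hZ
    have m6 := hN.meas_hT
    have m7 := hN.meas_t
    simp_rw [val_retained, N.indicator_U_eq]
    exact ((measurable_val (measurable_one.indicator hB)).comp (hT i)).mul
      ((measurable_iprod fun j => by fun_prop).mul ((measurable_iprod fun j => by fun_prop).mul
        (measurable_iprod fun j => by fun_prop)))
  simp_rw [count_eq_tsum]
  rw [lintegral_tsum fun i => (hU i).aemeasurable]
  simp_rw [hN.lintegral_val_retained hα hQ hρs hρd hlamY hlamZ hB]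
  rw [ENNReal.tsum_mul_left]
  -- The timer integral is moved outside so that the Mecke formula applies at each fixed timer
  -- value.
  have h1 : ∀ i, ∫⁻ ω, (∫⁻ s in Set.Icc (0 : ℝ) 1, val (B.indicator 1) (N.T i ω) *
        expNeg (∑' k, if k = i then 0 else
          link (exceedWeight (ρd / Q) α s) (N.T i ω) (N.T k ω))) ∂P =
      ∫⁻ s in Set.Icc (0 : ℝ) 1, ∫⁻ ω, val (B.indicator 1) (N.T i ω) *
        expNeg (∑' k, if k = i then 0 else
          link (exceedWeight (ρd / Q) α s) (N.T i ω) (N.T k ω)) ∂P := fun i =>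
    lintegral_lintegral_swap (hm i).aemeasurable
  simp_rw [h1]
  have hm' : ∀ i, Measurable fun s => ∫⁻ ω, val (B.indicator 1) (N.T i ω) *
        expNeg (∑' k, if k = i then 0 else
          link (exceedWeight (ρd / Q) α s) (N.T i ω) (N.T k ω)) ∂P := fun i =>
    ((hm i).comp measurable_swap).lintegral_prod_right'
  rw [← lintegral_tsum fun i => (hm' i).aemeasurable]
  have h2 : ∀ s ∈ Set.Icc (0 : ℝ) 1, ∑' i, ∫⁻ ω, val (B.indicator 1) (N.T i ω) *
        expNeg (∑' k, if k = i then 0 else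
          link (exceedWeight (ρd / Q) α s) (N.T i ω) (N.T k ω)) ∂P =
      ENNReal.ofReal (lamT * volume.real B) *
        ENNReal.ofReal (Real.exp (-(lamT * Kconst α ρd Q * s))) := fun s hs =>
    hN.pppT.campbell_exceedWeight hlamT.le hα hρd hQ hs.1 hs.2 hB hB'
  rw [setLIntegral_congr_fun measurableSet_Icc h2, lintegral_const_mul' _ _ ENNReal.ofReal_ne_top,
    lintegral_exp_neg_mul_Icc (by positivity), ← ENNReal.ofReal_mul (by positivity),
    ← ENNReal.ofReal_mul (Real.exp_pos _).le]
  congr 1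
  field_simp

end Density

/-! ### Independent thinning of a Poisson process. -/

/-- The probability of `k` successes out of `n` independent trials of success probability `β`. -/
noncomputable def binomWeight (β : ℝ) (k n : ℕ) : ℝ≥0∞ :=
  n.choose k * (ENNReal.ofReal β ^ k * (1 - ENNReal.ofReal β) ^ (n - k))

lemma tsum_binomWeight_mul_poissonMeasure {β : ℝ} (h0 : 0 ≤ β) (h1 : β ≤ 1) (r : ℝ≥0) (k : ℕ) :
    ∑' n : ℕ, binomWeight β k n * poissonMeasure r {n} =
      poissonMeasure (β * r).toNNReal {k} := by
  -- The terms with `n < k` vanish, so the sum may run over `n = m + k`.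
  have hs : Function.support (fun n => binomWeight β k n * poissonMeasure r {n}) ⊆
      Set.range (· + k) := by
    intro n hn
    by_contra h
    have hnk : n < k := by
      by_contra h'
      exact h ⟨n - k, Nat.sub_add_cancel (not_lt.1 h')⟩
    simp [binomWeight, Nat.choose_eq_zero_of_lt hnk] at hn
  rw [← (add_left_injective k).tsum_eq hs]
  -- Retained and discarded points separate: the term is a Poisson weight of mean `β r` at `k` times
  -- one of mean `(1 - β) r` at `m`. Summing over `m` leaves the first.
  have hterm : ∀ m : ℕ, binomWeight β k (m + k) * poissonMeasure r {m + k} =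
      poissonMeasure (β * r).toNNReal {k} * poissonMeasure ((1 - β) * r).toNNReal {m} := by
    intro m
    have h1' : 0 ≤ 1 - β := by linarith
    have hb : (1 : ℝ≥0∞) - ENNReal.ofReal β = ENNReal.ofReal (1 - β) := by
      rw [ENNReal.ofReal_sub _ h0, ENNReal.ofReal_one]
    rw [binomWeight, hb, Nat.add_sub_cancel, poissonMeasure_singleton, poissonMeasure_singleton,
      poissonMeasure_singleton, Real.coe_toNNReal _ (by positivity),
      Real.coe_toNNReal _ (by positivity), ← ENNReal.ofReal_natCast, ← ENNReal.ofReal_pow h0,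
      ← ENNReal.ofReal_pow h1', ← ENNReal.ofReal_mul (by positivity),
      ← ENNReal.ofReal_mul (by positivity), ← ENNReal.ofReal_mul (by positivity),
      ← ENNReal.ofReal_mul (by positivity)]
    congr 1
    have hc : ((m + k).choose k : ℝ) * (m.factorial * k.factorial) = (m + k).factorial := by
      have := Nat.add_choose_mul_factorial_mul_factorial m k
      rw [← mul_assoc]
      exact_mod_cast this
    have he : Real.exp (-(r : ℝ)) = Real.exp (-(β * r)) * Real.exp (-((1 - β) * r)) := by
      rw [← Real.exp_add]; congr 1; ring
    rw [he, ← hc]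
    have := Nat.factorial_ne_zero m
    have := Nat.factorial_ne_zero k
    have hch : ((m + k).choose k : ℝ) ≠ 0 := by
      exact_mod_cast (Nat.choose_pos (Nat.le_add_left k m)).ne'
    field_simp
    rw [mul_pow, mul_pow, pow_add]
    ring
  simp_rw [hterm]
  rw [ENNReal.tsum_mul_left]
  have : ∑' m : ℕ, poissonMeasure ((1 - β) * r).toNNReal {m} = 1 := by
    rw [← measure_univ (μ := poissonMeasure ((1 - β) * r).toNNReal),
      ← lintegral_one, lintegral_countable']
    simp
  rw [this, mul_one]

section Thinning

variable {Ω : Type*} [MeasurableSpace Ω] {P : Measure Ω} {X : ℕ → Ω → MaybePoint}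
  {V : ℕ → Ω → ℝ} {β lam : ℝ}

lemma measurable_retained (hX : ∀ n, Measurable (X n)) (hV : ∀ n, Measurable (V n)) (n : ℕ) :
    Measurable (retained X V n) := by
  classical
  exact Measurable.ite (hV n (measurableSet_singleton 1)) (hX n) measurable_const

open Classical in
lemma count_retained_eq {Ω : Type*} {X : ℕ → Ω → MaybePoint} {V : ℕ → Ω → ℝ} (A : Set Plane) (ω : Ω) (s : Finset ℕ)
    (hs : ∀ n, n ∈ s ↔ ∃ x ∈ A, X n ω = Sum.inl x) (ω' : Ω) :
    count (retained (fun n _ => X n ω) V) A ω' = (s.filter fun n => V n ω' = 1).card := by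
  rw [count, ← Set.encard_coe_eq_coe_finsetCard]
  congr 1
  ext n
  by_cases h : V n ω' = 1 <;> simp [retained, h, hs]

-- The event prescribes, for each index in the disjoint union of the `s i`, whether `V` equals `1`
-- there (`D` records which). It is thus an intersection of independent one-coordinate events.
open Classical in
lemma measure_filter_eq [IsProbabilityMeasure P] (hV : IsIndepRetention P X V β)
    {ι : Type*} [Fintype ι] {s J : ι → Finset ℕ}
    (hd : Pairwise (Function.onFun Disjoint s)) (hJ : ∀ i, J i ⊆ s i) :
    P {ω | ∀ i, (s i).filter (fun n => V n ω = 1) = J i} =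
      ∏ i, (ENNReal.ofReal β ^ (J i).card * (1 - ENNReal.ofReal β) ^ ((s i).card - (J i).card)) := by
  have hp1 : ∀ n, P (V n ⁻¹' {1}) = ENNReal.ofReal β := fun n => hV.prob n
  have hp0 : ∀ n, P (V n ⁻¹' {1}ᶜ) = 1 - ENNReal.ofReal β := fun n => by
    rw [Set.preimage_compl, prob_compl_eq_one_sub (hV.measurable n (measurableSet_singleton 1)),
      hp1]
  let D : ℕ → Set ℝ := fun n => if ∃ i, n ∈ J i then {1} else {1}ᶜ
  have hD : ∀ n, MeasurableSet (D n) := fun n => by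
    dsimp only [D]
    split_ifs
    · exact measurableSet_singleton 1
    · exact (measurableSet_singleton 1).compl
  have hmem : ∀ i, ∀ n ∈ s i, (∃ j, n ∈ J j) ↔ n ∈ J i := by
    intro i n hn
    refine ⟨fun ⟨j, hj⟩ => ?_, fun h => ⟨i, h⟩⟩
    by_cases hij : j = i
    · exact hij ▸ hj
    · exact absurd hn (Finset.disjoint_left.1 (hd hij) (hJ j hj))
  have hset : {ω | ∀ i, (s i).filter (fun n => V n ω = 1) = J i} =
      ⋂ n ∈ Finset.univ.biUnion s, V n ⁻¹' D n := by
    ext ω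
    simp only [Set.mem_ofPred_eq, Set.mem_iInter, Finset.mem_biUnion, Finset.mem_univ, true_and,
      Set.mem_preimage, forall_exists_index]
    constructor
    · intro h n i hn
      have hn' := Finset.ext_iff.1 (h i) n
      simp only [Finset.mem_filter, hn, true_and] at hn'
      by_cases hJn : n ∈ J i
      · simp only [D, (hmem i n hn).2 hJn, if_true]
        exact hn'.2 hJn
      · simp only [D, mt (hmem i n hn).1 hJn, if_false]
        exact mt hn'.1 hJn
    · intro h i
      ext n
      rw [Finset.mem_filter]
      constructor
      · rintro ⟨hn, hn1⟩
        by_contra hJn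
        have := h n i hn
        simp only [D, mt (hmem i n hn).1 hJn, if_false] at this
        exact this hn1
      · intro hJn
        refine ⟨hJ i hJn, ?_⟩
        have := h n i (hJ i hJn)
        simpa only [D, show ∃ j, n ∈ J j from ⟨i, hJn⟩, if_true, Set.mem_singleton_iff] using this
  rw [hset, hV.iid.measure_inter_preimage_eq_mul _ fun n _ => hD n,
    Finset.prod_biUnion fun i _ j _ hij => hd hij]
  refine Finset.prod_congr rfl fun i _ => ?_
  have : ∀ n ∈ s i, P (V n ⁻¹' D n) =
      if n ∈ J i then ENNReal.ofReal β else 1 - ENNReal.ofReal β := by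
    intro n hn
    by_cases hJn : n ∈ J i
    · simp only [D, (hmem i n hn).2 hJn, hJn, if_true, hp1]
    · simp only [D, mt (hmem i n hn).1 hJn, hJn, if_false, hp0]
  rw [Finset.prod_congr rfl this, Finset.prod_ite, Finset.prod_const, Finset.prod_const,
    Finset.filter_mem_eq_inter, Finset.inter_eq_right.2 (hJ i), Finset.filter_notMem_eq_sdiff,
    Finset.card_sdiff_of_subset (hJ i)]

-- The event splits according to the sets `J i` of successes; all choices of sizes `k i` have the
-- same probability, and binomial coefficients count them.
open Classical in
lemma measure_card_filter_eq [IsProbabilityMeasure P] (hV : IsIndepRetention P X V β)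
    {ι : Type*} [Fintype ι] {s : ι → Finset ℕ} (hd : Pairwise (Function.onFun Disjoint s))
    (k : ι → ℕ) :
    P {ω | ∀ i, ((s i).filter fun n => V n ω = 1).card = k i} =
      ∏ i, binomWeight β (k i) (s i).card := by
  have hset : {ω | ∀ i, ((s i).filter fun n => V n ω = 1).card = k i} =
      ⋃ J ∈ Fintype.piFinset fun i => (s i).powersetCard (k i),
        {ω | ∀ i, (s i).filter (fun n => V n ω = 1) = J i} := by
    ext ω
    simp only [Set.mem_ofPred_eq, Set.mem_iUnion, Fintype.mem_piFinset, Finset.mem_powersetCard,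
      exists_prop]
    constructor
    · intro h
      exact ⟨fun i => (s i).filter fun n => V n ω = 1,
        fun i => ⟨Finset.filter_subset _ _, h i⟩, fun i => rfl⟩
    · rintro ⟨J, hJ, h⟩ i
      rw [h i, (hJ i).2]
  rw [hset, measure_biUnion_finset]
  · rw [Finset.sum_congr rfl (g := fun _ => ∏ i, (ENNReal.ofReal β ^ k i *
      (1 - ENNReal.ofReal β) ^ ((s i).card - k i)))]
    · rw [Finset.sum_const, Fintype.card_piFinset, nsmul_eq_mul]
      push_cast
      rw [← Finset.prod_mul_distrib]
      refine Finset.prod_congr rfl fun i _ => ?_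
      rw [Finset.card_powersetCard, binomWeight]
    · intro J hJ
      have hJ' := fun i => Finset.mem_powersetCard.1 (Fintype.mem_piFinset.1 hJ i)
      rw [measure_filter_eq hV hd fun i => (hJ' i).1]
      refine Finset.prod_congr rfl fun i _ => ?_
      rw [(hJ' i).2]
  · intro J _ J' _ hne
    refine Set.disjoint_left.2 fun ω h h' => hne (funext fun i => ?_)
    exact (h i).symm.trans (h' i)
  · intro J _
    have : {ω | ∀ i, (s i).filter (fun n => V n ω = 1) = J i} =
        ⋂ i, ⋂ n, {ω | n ∈ (s i).filter (fun n => V n ω = 1) ↔ n ∈ J i} := by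
      ext ω
      simp [Finset.ext_iff]
    rw [this]
    refine MeasurableSet.iInter fun i => MeasurableSet.iInter fun n => ?_
    simp only [Finset.mem_filter]
    have h1 := hV.measurable n (measurableSet_singleton 1)
    have h2 : MeasurableSet {ω | n ∈ s i ∧ V n ω = 1} := (MeasurableSet.const _).inter h1
    by_cases hn : n ∈ J i
    · simpa [hn] using h2
    · have := h2.compl
      convert! this using 1
      ext ω; simp [hn]

lemma IsPPP.ae_count_ne_top [IsProbabilityMeasure P] (hX : IsPPP P X lam) (hlam : 0 ≤ lam)
    {A : Set Plane} (hA : MeasurableSet A) (hA' : volume A < ⊤) :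
    ∀ᵐ ω ∂P, count X A ω ≠ ⊤ := by
  have hlt : ∫⁻ ω, count X A ω ∂P ≠ ⊤ := by
    rw [hX.hasDensity hlam A hA hA']
    exact ENNReal.ofReal_ne_top
  filter_upwards [ae_lt_top (measurable_from_top.comp (measurable_count hX.measurable hA)) hlt]
    with ω hω h
  simp [h] at hω

/-- The joint law of the numbers of retained points in disjoint sets. -/
lemma IsPPP.measure_count_retained [IsProbabilityMeasure P] (hX : IsPPP P X lam)
    (hlam : 0 ≤ lam) (hV : IsIndepRetention P X V β) (h0 : 0 ≤ β) (h1 : β ≤ 1)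
    {ι : Type*} [Fintype ι] {A : ι → Set Plane} (hA : ∀ i, MeasurableSet (A i))
    (hA' : ∀ i, volume (A i) < ⊤) (hd : Pairwise (Function.onFun Disjoint A)) (k : ι → ℕ) :
    P {ω | ∀ i, count (retained X V) (A i) ω = k i} =
      ∏ i, poissonMeasure (β * (lam * volume.real (A i)).toNNReal).toNNReal {k i} := by
  classical
  have hXm := hX.measurable
  have hVm := hV.measurable
  -- Coordinate versions of the processes exhibit the event as the preimage of a measurable set `S`
  -- under the pair `(V, X)`, so that the positions can be frozen.
  let X' : ℕ → (ℕ → ℝ) × (ℕ → MaybePoint) → MaybePoint := fun n p => p.2 n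
  let V' : ℕ → (ℕ → ℝ) × (ℕ → MaybePoint) → ℝ := fun n p => p.1 n
  have hm' : ∀ i, Measurable (count (retained X' V') (A i)) := fun i =>
    measurable_count (measurable_retained (by fun_prop) (by fun_prop)) (hA i)
  let S : Set ((ℕ → ℝ) × (ℕ → MaybePoint)) := {p | ∀ i, count (retained X' V') (A i) p = k i}
  have hS : MeasurableSet S := by
    have : S = ⋂ i, count (retained X' V') (A i) ⁻¹' {(k i : ℕ∞)} := by
      ext p; simp [S]
    rw [this]
    exact MeasurableSet.iInter fun i => hm' i (measurableSet_singleton _)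
  have hSω : ∀ ω ω', S.indicator (fun _ => (1 : ℝ≥0∞)) (fun n => V n ω', fun n => X n ω) =
      {ω' | ∀ i, count (retained (fun n _ => X n ω) V) (A i) ω' = k i}.indicator 1 ω' :=
    fun ω ω' => rfl
  have hset : MeasurableSet {ω | ∀ i, count (retained X V) (A i) ω = k i} := by
    have : Measurable fun ω => ((fun n => V n ω, fun n => X n ω) :
      (ℕ → ℝ) × (ℕ → MaybePoint)) := by fun_prop
    exact this hS
  have hfreeze := hV.indep.symm.lintegral_comp (by fun_prop) (by fun_prop)
    (F := fun τ v => S.indicator (fun _ => (1 : ℝ≥0∞)) (v, τ))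
    ((measurable_const.indicator hS).comp measurable_swap)
  -- Almost sure finiteness makes the index sets finite, and makes `toNat` below faithful, since it
  -- sends `⊤` to `0`.
  have hfin : ∀ᵐ ω ∂P, ∀ i, count X (A i) ω ≠ ⊤ := by
    rw [ae_all_iff]
    exact fun i => hX.ae_count_ne_top hlam (hA i) (hA' i)
  calc _ = ∫⁻ ω, S.indicator (fun _ => (1 : ℝ≥0∞)) (fun n => V n ω, fun n => X n ω) ∂P := by
        rw [← lintegral_indicator_one hset]; rfl
    _ = ∫⁻ ω, ∏ i, binomWeight β (k i) (count X (A i) ω).toNat ∂P := by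
        rw [hfreeze]
        refine lintegral_congr_ae ?_
        filter_upwards [hfin] with ω hω
        have hf : ∀ i, {n : ℕ | ∃ x ∈ A i, X n ω = Sum.inl x}.Finite := fun i =>
          Set.encard_ne_top_iff.1 (hω i)
        let s : ι → Finset ℕ := fun i => (hf i).toFinset
        have hs : ∀ i n, n ∈ s i ↔ ∃ x ∈ A i, X n ω = Sum.inl x := fun i n => by simp [s]
        have hsd : Pairwise (Function.onFun Disjoint s) := fun i j hij =>
          Finset.disjoint_left.2 fun n hn hn' => by
            obtain ⟨x, hx, hxn⟩ := (hs i n).1 hn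
            obtain ⟨y, hy, hyn⟩ := (hs j n).1 hn'
            have hxy : x = y := Sum.inl_injective (hxn.symm.trans hyn)
            exact Set.disjoint_left.1 (hd hij) hx (hxy ▸ hy)
        have hcard : ∀ i, (count X (A i) ω).toNat = (s i).card := fun i => by
          rw [count, (hf i).encard_eq_coe_toFinset_card]; rfl
        simp_rw [hSω, hcard, ← measure_card_filter_eq hV hsd]
        rw [lintegral_indicator_one]
        · congr 1
          ext ω'
          simp only [Set.mem_ofPred_eq]
          refine forall_congr' fun i => ?_
          rw [count_retained_eq (A i) ω (s i) (hs i) ω']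
          exact Nat.cast_inj
        · have : Measurable fun ω' => ((fun n => V n ω', fun n => X n ω) :
            (ℕ → ℝ) × (ℕ → MaybePoint)) := by fun_prop
          exact this hS
    _ = _ := by
        have hI := (hX.iIndepFun_count hA hA' hd).comp
          (fun i (n : ℕ∞) => binomWeight β (k i) n.toNat) fun i => measurable_from_top
        refine (lintegral_prod_eq_prod_lintegral_of_indepFun Finset.univ _ hI fun i =>
          measurable_from_top.comp (measurable_count hXm (hA i))).trans ?_
        refine Finset.prod_congr rfl fun i _ => ?_
        refine (hX.lintegral_count_comp (hA i) (hA' i)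
          fun n => binomWeight β (k i) n.toNat).trans ?_
        simp only [ENat.toNat_natCast]
        exact tsum_binomWeight_mul_poissonMeasure h0 h1 _ _

lemma count_retained_le {Ω : Type*} (X : ℕ → Ω → MaybePoint) (V : ℕ → Ω → ℝ) (A : Set Plane)
    (ω : Ω) : count (retained X V) A ω ≤ count X A ω := by
  refine Set.encard_le_encard fun n hn => ?_
  obtain ⟨x, hx, hn⟩ := hn
  by_cases h : V n ω = 1 <;> simp [retained, h] at hn
  exact ⟨x, hx, hn⟩

/-- Independent thinning of a Poisson point process. -/
theorem IsPPP.retained [IsProbabilityMeasure P] (hX : IsPPP P X lam) (hlam : 0 ≤ lam)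
    (hV : IsIndepRetention P X V β) (h0 : 0 ≤ β) (h1 : β ≤ 1) :
    IsPPP P (retained X V) (β * lam) := by
  have hm := measurable_retained hX.measurable hV.measurable
  have hpois : ∀ A : Set Plane, MeasurableSet A → volume A < ⊤ → ∀ k : ℕ,
      P {ω | count (_root_.retained X V) A ω = k} =
        poissonMeasure (β * lam * volume.real A).toNNReal {k} := by
    intro A hA hA' k
    have h := hX.measure_count_retained hlam hV h0 h1 (ι := Unit) (A := fun _ => A)
      (fun _ => hA) (fun _ => hA') (fun i j hij => absurd rfl hij) fun _ => k
    rw [Real.coe_toNNReal _ (by positivity)] at h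
    simpa [mul_assoc] using h
  refine ⟨hm, hpois, fun m A hA hA' hd => ?_⟩
  have hc : ∀ i, Measurable (count (_root_.retained X V) (A i)) := fun i =>
    measurable_count hm (hA i)
  rw [iIndepFun_iff_map_fun_eq_pi_map fun i => (hc i).aemeasurable]
  have := fun i => Measure.isProbabilityMeasure_map (μ := P) (hc i).aemeasurable
  -- The counts take values in a countable space, so independence can be checked on single values;
  -- those with a coordinate `⊤` have probability zero on both sides.
  refine Measure.ext_of_singleton fun a => ?_
  have hl : P.map (fun ω i => count (_root_.retained X V) (A i) ω) {a} =
      P {ω | ∀ i, count (_root_.retained X V) (A i) ω = a i} := by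
    rw [Measure.map_apply (measurable_pi_lambda _ hc) (measurableSet_singleton a)]
    congr 1
    ext ω
    simp [funext_iff]
  have hr : ∀ i, P.map (count (_root_.retained X V) (A i)) {a i} =
      P {ω | count (_root_.retained X V) (A i) ω = a i} := fun i =>
    Measure.map_apply (hc i) (measurableSet_singleton (a i))
  rw [hl, Measure.pi_singleton]
  simp_rw [hr]
  by_cases ha : ∃ i, a i = ⊤
  · obtain ⟨i, hi⟩ := ha
    have hz : P {ω | count (_root_.retained X V) (A i) ω = a i} = 0 := by
      refine measure_mono_null (fun ω hω => ?_) (hX.ae_count_ne_top hlam (hA i) (hA' i))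
      simp only [Set.mem_compl_iff, Set.mem_ofPred_eq, not_not]
      refine top_le_iff.1 ?_
      rw [← hi, ← show count (_root_.retained X V) (A i) ω = a i from hω]
      exact count_retained_le X V (A i) ω
    rw [Finset.prod_eq_zero (Finset.mem_univ i) hz]
    exact measure_mono_null (fun ω hω => hω i) hz
  · push Not at ha
    lift a to Fin m → ℕ using ha
    rw [hX.measure_count_retained hlam hV h0 h1 hA hA' fun i j hij => hd i j hij]
    refine Finset.prod_congr rfl fun i _ => ?_
    rw [hpois (A i) (hA i) (hA' i), Real.coe_toNNReal _ (by positivity), mul_assoc]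

end Thinning

end

/-! ### Assembly of the retaining probability, the density and the thinned process. -/

theorem lemma2 {Ω : Type*} [MeasurableSpace Ω] (P : Measure Ω) [IsProbabilityMeasure P]
    (N : Network Ω) (α Q ρs ρd lamY lamZ ζ lamU : ℝ)
    (hα : 2 < α) (hQ : 0 < Q) (hρs : 0 < ρs) (hρd : 0 < ρd)
    (hlamY : 0 ≤ lamY) (hlamZ : 0 ≤ lamZ) (hζ : 0 < ζ) (hζ1 : ζ ≤ 1) (hlamU : 0 < lamU)
    (hN : N.IsModel P lamY lamZ (ζ * lamU)) :
    -- the retaining probability of a potential D2D transmitter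
    (∀ B : Set Plane, MeasurableSet B → 0 < volume B → volume B < ⊤ →
      retainingProb P N.T (N.U Q α ρs ρd) B =
        ENNReal.ofReal (betaFormula α Q ρs ρd lamY lamZ ζ lamU)) ∧
    -- the density of the D2D transmitters retained by the CSMA scheme
    HasDensity P (retained N.T (N.U Q α ρs ρd)) (lamDFormula α Q ρs ρd lamY lamZ ζ lamU) ∧
    -- with independent retention, the retained transmitters form a PPP of the same density
    (∀ V : ℕ → Ω → ℝ, IsIndepRetention P N.T V (betaFormula α Q ρs ρd lamY lamZ ζ lamU) →
      IsPPP P (retained N.T V) (lamDFormula α Q ρs ρd lamY lamZ ζ lamU) ∧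
      HasDensity P (retained N.T V) (lamDFormula α Q ρs ρd lamY lamZ ζ lamU)) ∧
    lamDFormula α Q ρs ρd lamY lamZ ζ lamU =
      betaFormula α Q ρs ρd lamY lamZ ζ lamU * ζ * lamU := by

  have hα0 : 0 < α := by linarith
  have hlam : 0 < ζ * lamU := by positivity
  have hK := Kconst_pos hα0 hρd hQ
  have hKs := Kconst_pos hα0 hρs hQ
  have hx : 0 < ζ * lamU * Kconst α ρd Q := by positivity
  have hD : HasDensity P (retained N.T (N.U Q α ρs ρd))
      (lamDFormula α Q ρs ρd lamY lamZ ζ lamU) :=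
    hN.hasDensity_retained hα0 hQ hρs hρd hlamY hlamZ hlam
  have heq : lamDFormula α Q ρs ρd lamY lamZ ζ lamU =
      betaFormula α Q ρs ρd lamY lamZ ζ lamU * (ζ * lamU) := by
    unfold lamDFormula betaFormula
    field_simp
  have he1 : Real.exp (-(ζ * lamU * Kconst α ρd Q)) ≤ 1 := Real.exp_le_one_iff.2 (by linarith)
  have hβ0 : 0 ≤ betaFormula α Q ρs ρd lamY lamZ ζ lamU :=
    mul_nonneg (Real.exp_pos _).le (div_nonneg (by linarith) hx.le)
  have hβ1 : betaFormula α Q ρs ρd lamY lamZ ζ lamU ≤ 1 := by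
    refine mul_le_one₀ (Real.exp_le_one_iff.2 ?_) (div_nonneg (by linarith) hx.le) ?_
    · have : 0 ≤ (lamY + lamZ) * Kconst α ρs Q := by positivity
      linarith
    -- The bound `1 - x ≤ exp (-x)` gives `(1 - exp (-x)) / x ≤ 1`, so that the closed form is a
    -- probability, as thinning requires.
    · rw [div_le_one hx]
      have := Real.add_one_le_exp (-(ζ * lamU * Kconst α ρd Q))
      linarith
  refine ⟨fun B hB hB0 hB' => ?_, hD, fun V hV => ?_, by rw [heq, mul_assoc]⟩
  · have hBr : 0 < volume.real B := ENNReal.toReal_pos hB0.ne' hB'.ne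
    rw [retainingProb, hD B hB hB', hN.pppT.hasDensity hlam.le B hB hB',
      ← ENNReal.ofReal_div_of_pos (by positivity), heq]
    congr 1
    field_simp
  · have h := hN.pppT.retained hlam.le hV hβ0 hβ1
    rw [← heq] at h
    exact ⟨h, h.hasDensity (heq ▸ mul_nonneg hβ0 hlam.le)⟩
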